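/- Let $\mathbb T=\mathbb R/\mathbb Z$ (unit volume). For $T>0$ put $M_T(v)=e^{-v^2/(2T)}/\sqrt{2\pi T}$, $v\in\mathbb R$. For $T_1,T_2>0$ and $\alpha\in[0,1]$, a *steady state (NESS)* of the one-dimensional BGK equation with reservoirs is a function $f\in L^1(\mathbb T\times\mathbb R)$, $f\ge 0$ a.e., with $\iint f\,dx\,dv=1$ and $\iint v^2 f\,dx\,dv<\infty$, that satisfies $$ v\,\partial_x f=\alpha\,\mathcal M_f+(1-\alpha)\,\rho_f\,\frac{M_{T_1}+M_{T_2}}2-f $$ weakly, i.e. when tested against every $\varphi\in C_c^\infty(\mathbb T\times\mathbb R)$. Here $\rho_f(x)=\int_{\mathbb R} f(x,v)\,dv$ is the spatial density, the local temperature $T_f$ is given by $\rho_f(x)T_f(x)=\int_{\mathbb R} v^2f(x,v)\,dv$, and $\mathcal M_f(x,v)=\rho_f(x)M_{T_f(x)}(v)$ (read as $0$ where $\rho_f(x)=0$). **Theorem 1.1.** For all $T_1,T_2>0$ there is an explicitly computable $\alpha_0=\alpha_0(T_1,T_2)>0$ such that for every $\alpha\in[0,\alpha_0)$ every steady state $f$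 (in $L^1(\mathbb T\times\mathbb R)$ and with finite second moment, as above) whose spatial density satisfies $\rho_f\in L^p(\mathbb T)$ for some $p>1$ is constant in $x$: $f(x,v)=g(v)$ a.e. for some function $g$. Moreover, with $T_\infty=(T_1+T_2)/2$, $$f_\infty(v)=\alpha M_{T_\infty}(v)+(1-\alpha)\frac{M_{T_1}(v)+M_{T_2}(v)}2$$ is such a steady state, and it is the only one up to null sets. The threshold $\alpha_0$ depends only on $T_1,T_2$ (not on $f$ or $p$). "Explicitly computable" means that there is a computable function $a:\mathbb N\to\mathbb N$ such that, for all $T_1,T_2>0$, one may take $\alpha_0=1/(a(N)+1)$ for any natural number $N$ with $1/N\le T_1\le N$ and $1/N\le T_2\le N$. -/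

import Mathlib

open MeasureTheory
open scoped ContDiff

namespace BGK

/-- The phase space `𝕋 × ℝ`, with `𝕋 = ℝ / ℤ` of unit volume. Its `volume` is the product of
the normalized Haar measure on `𝕋` and Lebesgue measure on `ℝ`. -/
abbrev Phase : Type := UnitAddCircle × ℝ

/-- The centred Maxwellian `M_T(v)` of temperature `T`. -/
noncomputable def maxwellian (T v : ℝ) : ℝ :=
  Real.exp (-v ^ 2 / (2 * T)) / Real.sqrt (2 * Real.pi * T)

/-- The reservoir profile `(M_{T₁} + M_{T₂}) / 2`. -/
noncomputable def reservoir (T₁ T₂ v : ℝ) : ℝ :=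
  (maxwellian T₁ v + maxwellian T₂ v) / 2

/-- The spatial density `ρ_f(x) = ∫ f(x,v) dv`. -/
noncomputable def density (f : Phase → ℝ) (x : UnitAddCircle) : ℝ :=
  ∫ v : ℝ, f (x, v)

/-- The pressure `P_f(x) = ∫ v² f(x,v) dv`. -/
noncomputable def pressure (f : Phase → ℝ) (x : UnitAddCircle) : ℝ :=
  ∫ v : ℝ, v ^ 2 * f (x, v)

/-- The local temperature `T_f`, determined by `P_f = ρ_f T_f`. Where `ρ_f = 0` its value is
irrelevant, because it only enters through `ρ_f M_{T_f}`. -/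
noncomputable def temperature (f : Phase → ℝ) (x : UnitAddCircle) : ℝ :=
  pressure f x / density f x

/-- The local Maxwellian `𝓜_f(x,v) = ρ_f(x) M_{T_f(x)}(v)`. -/
noncomputable def localMaxwellian (f : Phase → ℝ) (z : Phase) : ℝ :=
  density f z.1 * maxwellian (temperature f z.1) z.2

/-- The gain term `α 𝓜_f + (1 - α) ρ_f (M_{T₁} + M_{T₂}) / 2`. -/
noncomputable def gain (T₁ T₂ α : ℝ) (f : Phase → ℝ) (z : Phase) : ℝ :=
  α * localMaxwellian f z + (1 - α) * density f z.1 * reservoir T₁ T₂ z.2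

/-- Test functions: `φ ∈ C_c^∞(𝕋 × ℝ)`, where smoothness means smoothness of the function on
`ℝ × ℝ`, periodic in the first variable, that `φ` lifts to. -/
def IsTest (φ : Phase → ℝ) : Prop :=
  ContDiff ℝ ∞ (fun y : ℝ × ℝ => φ ((y.1 : UnitAddCircle), y.2)) ∧ HasCompactSupport φ

/-- The derivative in the position variable, `∂ₓ φ(x,v)`, on `𝕋 × ℝ`. -/
noncomputable def dx (φ : Phase → ℝ) (z : Phase) : ℝ :=
  deriv (fun s : ℝ => φ (z.1 + (s : UnitAddCircle), z.2)) 0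

/-- `f` is a steady state of the BGK equation with reservoirs,
`v ∂ₓ f = α 𝓜_f + (1 - α) ρ_f (M_{T₁} + M_{T₂}) / 2 - f` on `𝕋 × ℝ` in the weak sense:
it is a probability density on `𝕋 × ℝ` in `L¹` with finite second moment. -/
structure IsSteadyState (T₁ T₂ α : ℝ) (f : Phase → ℝ) : Prop where
  integrable : Integrable f volume
  nonneg : ∀ᵐ z : Phase, 0 ≤ f z
  mass_one : ∫ z : Phase, f z = 1
  second_moment : Integrable (fun z : Phase => z.2 ^ 2 * f z) volume
  weak_eq : ∀ φ : Phase → ℝ, IsTest φ →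
    -∫ z : Phase, z.2 * f z * dx φ z = ∫ z : Phase, (gain T₁ T₂ α f z - f z) * φ z

/-- The spatially uniform profile
`f_∞(v) = α M_{T_∞}(v) + (1 - α) (M_{T₁}(v) + M_{T₂}(v)) / 2`, `T_∞ = (T₁ + T₂) / 2`. -/
noncomputable def uniformState (T₁ T₂ α v : ℝ) : ℝ :=
  α * maxwellian ((T₁ + T₂) / 2) v + (1 - α) * reservoir T₁ T₂ v

end BGK

/-!
A steady state satisfies `v ∂ₓ f + f = G`, where `G` is the gain term, and everything is read off
from this equation after a Fourier transform in `x`, `(1 - 2πikv) f_k(v) = G_k(v)` for a.e. `v`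
(`BGK.IsSteadyState.ae_integral_modeDefect`).

Taking the moments `1`, `v`, `v²` of this relation shows that the momentum and then the pressure
`ρ_f T_f` have no nonzero modes, and that the mean of the pressure is `T_∞ = (T₁ + T₂) / 2`. So the
pressure is the constant `T_∞` (`BGK.IsSteadyState.ae_pressure_eq`), the local temperature is
`T_∞ / ρ_f`, and the gain term is a function of `ρ = ρ_f` alone:
`G = α ρ M_{T_∞ / ρ} + (1 - α) ρ R` with the reservoir profile `R`.

Dividing by `1 - 2πikv` and integrating in `v` gives a closed equation for `ρ`. In dual form,
`∫ ρ ψ dx = ∫∫ G A ψ dx dv`, where `A ψ(x, v) = ∫₀^∞ e^{-s} ψ(x + s v) ds` is the average of `ψ`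
along the free flight (`BGK.flightAverage`). The uniform state solves the same equation with
`ρ = 1`; subtracting, one estimates `h = ρ - 1` in `L¹`.

* The linear part is a contraction. The particles that leave the reservoirs with velocity in
  `[0, 1]` and fly for a time in `[1, 2]` cover the circle, so that `∫ R A ψ dv` is a fixed multiple
  `c ∫ ψ` of the mean plus a remainder of size at most `(1 - c) sup |ψ|`; since `h` has mean zero,
  only the remainder is seen (`BGK.abs_integral_mul_flightAverage_sub_le`).
* The nonlinear part is Lipschitz: `∫ |ρ M_{T_∞ / ρ} - M_{T_∞}| dv ≤ 3 |ρ - 1|` for every `ρ > 0`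
  (`BGK.integral_abs_isobaric_sub_le`). By scale invariance in `v` no bounds on `ρ` enter.

Hence `‖h‖₁ ≤ ((1 - α)(1 - c) + 3α) ‖h‖₁`, and `h = 0` as soon as `3α < c ≤ 1`. The constant `c` is
bounded below by an explicit function of `N`. Once `ρ = 1`, the gain term is the uniform state and
the relation between Fourier modes determines `f`.
-/

namespace BGK

/-! ### Moments of Maxwellians -/

lemma maxwellian_eq_gaussianPDFReal {T : ℝ} (hT : 0 ≤ T) (v : ℝ) :
    maxwellian T v = ProbabilityTheory.gaussianPDFReal 0 T.toNNReal v := by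
  simp [maxwellian, ProbabilityTheory.gaussianPDFReal, div_eq_inv_mul, Real.coe_toNNReal T hT]

lemma maxwellian_nonneg (T v : ℝ) : 0 ≤ maxwellian T v := by
  unfold maxwellian; positivity

lemma maxwellian_zero (v : ℝ) : maxwellian 0 v = 0 := by simp [maxwellian]

lemma maxwellian_neg (T v : ℝ) : maxwellian T (-v) = maxwellian T v := by simp [maxwellian]

lemma measurable_maxwellian : Measurable fun y : ℝ × ℝ => maxwellian y.1 y.2 := by
  unfold maxwellian; fun_prop

lemma integrable_maxwellian {T : ℝ} (hT : 0 ≤ T) : Integrable (maxwellian T) := by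
  rw [funext (maxwellian_eq_gaussianPDFReal hT)]
  exact ProbabilityTheory.integrable_gaussianPDFReal _ _

lemma integral_maxwellian {T : ℝ} (hT : 0 < T) : ∫ v, maxwellian T v = 1 := by
  rw [funext (maxwellian_eq_gaussianPDFReal hT.le)]
  exact ProbabilityTheory.integral_gaussianPDFReal_eq_one _ (by simpa using hT)

lemma integrable_sq_mul_maxwellian {T : ℝ} (hT : 0 ≤ T) :
    Integrable fun v => v ^ 2 * maxwellian T v := by
  rcases hT.eq_or_lt with rfl | hT
  · simp [maxwellian_zero]
  · have := (integrable_rpow_mul_exp_neg_mul_sq (b := 1 / (2 * T)) (by positivity)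
      (s := 2) (by norm_num)).div_const (Real.sqrt (2 * Real.pi * T))
    refine this.congr (.of_forall fun v => ?_)
    simp only [maxwellian, Real.rpow_two]
    rw [mul_div_assoc]; congr 3; ring

/-- Valid for `T = 0` as well, where `maxwellian 0 = 0`. -/
lemma integral_sq_mul_maxwellian {T : ℝ} (hT : 0 ≤ T) :
    ∫ v, v ^ 2 * maxwellian T v = T := by
  rcases hT.eq_or_lt with rfl | hT
  · simp [maxwellian_zero]
  · have hne : T.toNNReal ≠ 0 := by simpa using hT
    have h := ProbabilityTheory.variance_fun_id_gaussianReal (μ := 0) (v := T.toNNReal)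
    rw [ProbabilityTheory.variance_eq_integral (by fun_prop),
      ProbabilityTheory.integral_id_gaussianReal,
      ProbabilityTheory.integral_gaussianReal_eq_integral_smul hne] at h
    rw [funext (maxwellian_eq_gaussianPDFReal hT.le)]
    simpa [mul_comm, hT.le] using h

lemma integrable_mul_of_integrable_sq_mul {Ω : Type*} [MeasurableSpace Ω] {μ : Measure Ω}
    {w g : Ω → ℝ} (hw : Measurable w) (h0 : Integrable g μ)
    (h2 : Integrable (fun z => w z ^ 2 * g z) μ) : Integrable (fun z => w z * g z) μ := by
  refine (h0.norm.add h2.norm).mono' (hw.aestronglyMeasurable.mul h0.aestronglyMeasurable)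
    (.of_forall fun v => ?_)
  have h1 : |w v| ≤ 1 + |w v| ^ 2 := by nlinarith [sq_nonneg (|w v| - 1)]
  simp only [Real.norm_eq_abs, abs_mul, Pi.add_apply, abs_pow]
  nlinarith [abs_nonneg (g v)]

lemma integral_mul_even {g : ℝ → ℝ} (hg : ∀ v, g (-v) = g v) : ∫ v, v * g v = 0 := by
  have h := integral_neg_eq_self (fun v => v * g v) volume
  simp only [hg, neg_mul, integral_neg] at h
  linarith

/-- Total variation bound between two Maxwellians: with `r = √(S / T)`, the function `r * M_S` lies
below both `M_S` and `M_T` and has integral `r ≥ S / T`. -/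
lemma integral_abs_maxwellian_sub_le {S T : ℝ} (hS : 0 < S) (hST : S ≤ T) :
    ∫ v, |maxwellian S v - maxwellian T v| ≤ 2 * (1 - S / T) := by
  have hT : 0 < T := hS.trans_le hST
  set r := Real.sqrt (S / T) with hr
  have hr1 : r ≤ 1 := Real.sqrt_le_one.2 ((div_le_one hT).2 hST)
  have hr2 : r ^ 2 = S / T := Real.sq_sqrt (by positivity)
  have hr0 : 0 ≤ r := Real.sqrt_nonneg _
  have key (v : ℝ) : r * maxwellian S v ≤ maxwellian T v := by
    have h1 : r * maxwellian S v = Real.exp (-v ^ 2 / (2 * S)) / Real.sqrt (2 * Real.pi * T) := by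
      have hs : Real.sqrt (2 * Real.pi * S) = r * Real.sqrt (2 * Real.pi * T) := by
        rw [hr, ← Real.sqrt_mul (by positivity)]; congr 1; field_simp
      have : 0 < r := Real.sqrt_pos.2 (by positivity)
      rw [maxwellian, hs]; field_simp
    rw [h1, maxwellian]
    gcongr ?_ / _
    rw [Real.exp_le_exp, neg_div, neg_div, neg_le_neg_iff]
    gcongr
  have iS := integrable_maxwellian hS.le
  have iT := integrable_maxwellian hT.le
  calc ∫ v, |maxwellian S v - maxwellian T v|
      ≤ ∫ v, ((1 - 2 * r) * maxwellian S v + maxwellian T v) := by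
        refine integral_mono (iS.sub iT).abs ((iS.const_mul _).add iT) fun v => ?_
        have := key v
        have := maxwellian_nonneg S v
        rw [abs_le]; constructor <;> nlinarith
    _ = 2 * (1 - r) := by
        rw [integral_add (iS.const_mul _) iT, integral_const_mul, integral_maxwellian hS,
          integral_maxwellian hT]; ring
    _ ≤ 2 * (1 - S / T) := by nlinarith

/-- At constant pressure `P` the local Maxwellian, as a function of the density `r`, is Lipschitz
in `L¹` at `r = 1`. No upper or lower bound on `r` enters the constant. -/
lemma integral_abs_isobaric_sub_le {P r : ℝ} (hP : 0 < P) (hr : 0 < r) :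
    ∫ v, |r * maxwellian (P / r) v - maxwellian P v| ≤ 3 * |r - 1| := by
  have hT : 0 < P / r := by positivity
  have iT := integrable_maxwellian hT.le
  have iP := integrable_maxwellian hP.le
  have hdiff : ∫ v, |maxwellian (P / r) v - maxwellian P v| ≤ 2 * |r - 1| := by
    rcases le_total 1 r with h | h
    · refine (integral_abs_maxwellian_sub_le hT (div_le_self hP.le h)).trans ?_
      rw [abs_of_nonneg (by linarith)]
      have : P / r / P = 1 / r := by field_simp
      rw [this]
      have h1 : 1 / r * r = 1 := by field_simp
      have : 0 < 1 / r := by positivity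
      nlinarith
    · simp_rw [abs_sub_comm (maxwellian (P / r) _)]
      refine (integral_abs_maxwellian_sub_le hP (by rw [le_div_iff₀ hr]; nlinarith)).trans ?_
      rw [abs_of_nonpos (by linarith)]
      have : P / (P / r) = r := by field_simp
      rw [this]; linarith
  calc ∫ v, |r * maxwellian (P / r) v - maxwellian P v|
      ≤ ∫ v, (|r - 1| * maxwellian (P / r) v + |maxwellian (P / r) v - maxwellian P v|) := by
        refine integral_mono ((iT.const_mul _).sub iP).abs
          ((iT.const_mul _).add (iT.sub iP).abs) fun v => ?_
        have : r * maxwellian (P / r) v - maxwellian P v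
          = (r - 1) * maxwellian (P / r) v + (maxwellian (P / r) v - maxwellian P v) := by ring
        simp only [this]
        refine (abs_add_le _ _).trans ?_
        rw [abs_mul, abs_of_nonneg (maxwellian_nonneg _ _)]
    _ = |r - 1| + ∫ v, |maxwellian (P / r) v - maxwellian P v| := by
        have iD : Integrable fun v => |maxwellian (P / r) v - maxwellian P v| := (iT.sub iP).abs
        rw [integral_add (iT.const_mul _) iD, integral_const_mul, integral_maxwellian hT, mul_one]
    _ ≤ 3 * |r - 1| := by linarith

section Reservoir

variable {T₁ T₂ : ℝ}

lemma measurable_reservoir : Measurable (reservoir T₁ T₂) := by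
  unfold reservoir maxwellian; fun_prop

lemma reservoir_nonneg (v : ℝ) : 0 ≤ reservoir T₁ T₂ v := by
  have := maxwellian_nonneg T₁ v
  have := maxwellian_nonneg T₂ v
  unfold reservoir; positivity

lemma reservoir_neg (v : ℝ) : reservoir T₁ T₂ (-v) = reservoir T₁ T₂ v := by
  simp [reservoir, maxwellian_neg]

lemma integrable_reservoir (h₁ : 0 < T₁) (h₂ : 0 < T₂) : Integrable (reservoir T₁ T₂) :=
  ((integrable_maxwellian h₁.le).add (integrable_maxwellian h₂.le)).div_const 2

lemma integral_reservoir (h₁ : 0 < T₁) (h₂ : 0 < T₂) : ∫ v, reservoir T₁ T₂ v = 1 := by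
  unfold reservoir
  rw [integral_div, integral_add (integrable_maxwellian h₁.le) (integrable_maxwellian h₂.le),
    integral_maxwellian h₁, integral_maxwellian h₂]
  norm_num

lemma integrable_sq_mul_reservoir (h₁ : 0 < T₁) (h₂ : 0 < T₂) :
    Integrable fun v => v ^ 2 * reservoir T₁ T₂ v := by
  refine (((integrable_sq_mul_maxwellian h₁.le).add
    (integrable_sq_mul_maxwellian h₂.le)).div_const 2).congr (.of_forall fun v => ?_)
  simp only [Pi.add_apply, reservoir]; ring

lemma integral_sq_mul_reservoir (h₁ : 0 < T₁) (h₂ : 0 < T₂) :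
    ∫ v, v ^ 2 * reservoir T₁ T₂ v = (T₁ + T₂) / 2 := by
  have (v : ℝ) : v ^ 2 * reservoir T₁ T₂ v
    = (v ^ 2 * maxwellian T₁ v + v ^ 2 * maxwellian T₂ v) / 2 := by unfold reservoir; ring
  simp_rw [this]
  rw [integral_div, integral_add (integrable_sq_mul_maxwellian h₁.le)
    (integrable_sq_mul_maxwellian h₂.le), integral_sq_mul_maxwellian h₁.le,
    integral_sq_mul_maxwellian h₂.le]

lemma maxwellian_lower_bound {T N v : ℝ} (hT : 0 < T) (hN : T ≤ N) (hN' : 1 / T ≤ N)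
    (hv0 : 0 ≤ v) (hv : v ≤ 1) :
    Real.exp (-N / 2) / Real.sqrt (2 * Real.pi * N) ≤ maxwellian T v := by
  unfold maxwellian
  gcongr ?_ / ?_
  · rw [Real.exp_le_exp, neg_div, neg_div, neg_le_neg_iff]
    calc v ^ 2 / (2 * T) ≤ 1 / (2 * T) := by gcongr; nlinarith
      _ = 1 / T / 2 := by field_simp
      _ ≤ N / 2 := by gcongr
  · gcongr

end Reservoir

/-! ### Continuous and trigonometric test functions on the circle -/

instance : IsProbabilityMeasure (volume : Measure UnitAddCircle) :=
  ⟨UnitAddCircle.measure_univ⟩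

lemma fourier_add_coe (k : ℤ) (x y : UnitAddCircle) :
    (fourier k (x + y) : ℂ) = fourier k x * fourier k y := by
  simp only [fourier_apply, smul_add, AddCircle.toCircle_add, Circle.coe_mul]

lemma integral_fourier_eq_zero {k : ℤ} (hk : k ≠ 0) :
    ∫ x : UnitAddCircle, (fourier k x : ℂ) = 0 := by
  have h := integral_add_right_eq_self (μ := (volume : Measure UnitAddCircle))
    (fun x => (fourier k x : ℂ)) ((1 / 2 / k : ℝ) : UnitAddCircle)
  simp only [fourier_add_half_inv_index hk one_pos, integral_neg] at h
  exact self_eq_neg.1 h.symm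

/-- The `L¹` norm is attained, up to `ε`, by testing against `g / (|g| + δ)`, where `g` is
continuous and close to `h` in `L¹`. -/
lemma integral_abs_le_of_forall_continuous {h : UnitAddCircle → ℝ} (hh : Integrable h) {C : ℝ}
    (H : ∀ ψ : C(UnitAddCircle, ℝ), (∀ x, |ψ x| ≤ 1) → ∫ x, h x * ψ x ≤ C) :
    ∫ x, |h x| ≤ C := by
  refine le_of_forall_pos_le_add fun ε hε => ?_
  obtain ⟨g, -, hg, hgc, hgi⟩ := hh.exists_hasCompactSupport_integral_sub_le
    (show (0 : ℝ) < ε / 4 by positivity)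
  set δ := ε / 4 with hδ
  have hδ0 : 0 < δ := by positivity
  have hpos (x) : 0 < |g x| + δ := by positivity
  let ψ : C(UnitAddCircle, ℝ) :=
    ⟨fun x => g x / (|g x| + δ), hgc.div (hgc.abs.add continuous_const) fun x => (hpos x).ne'⟩
  have hψ1 (x) : |ψ x| ≤ 1 := by
    change |g x / (|g x| + δ)| ≤ 1
    rw [abs_div, abs_of_pos (hpos x), div_le_one (hpos x)]
    linarith
  have hψg (x) : |g x| - δ ≤ g x * ψ x := by
    change |g x| - δ ≤ g x * (g x / (|g x| + δ))
    rw [← mul_div_assoc, le_div_iff₀ (hpos x), ← abs_mul_abs_self (g x)]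
    nlinarith
  have hpt (x) : |h x| ≤ h x * ψ x + (2 * ‖h x - g x‖ + δ) := by
    have h1 : |h x| ≤ |g x| + |h x - g x| := by
      have := abs_add_le (g x) (h x - g x); simpa using this
    have h2 : -|h x - g x| ≤ (h x - g x) * ψ x := by
      have := neg_abs_le ((h x - g x) * ψ x)
      rw [abs_mul] at this
      nlinarith [hψ1 x, abs_nonneg (h x - g x)]
    rw [Real.norm_eq_abs]
    linarith [hψg x]
  have i1 : Integrable fun x => h x * ψ x :=
    hh.mul_bdd (c := 1) ψ.continuous.aestronglyMeasurable (.of_forall hψ1)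
  have i2 : Integrable fun x => 2 * ‖h x - g x‖ := (hh.sub hgi).norm.const_mul 2
  have i3 : Integrable fun _ : UnitAddCircle => δ := integrable_const _
  calc ∫ x, |h x| ≤ ∫ x, (h x * ψ x + (2 * ‖h x - g x‖ + δ)) :=
        integral_mono hh.abs (i1.add (i2.add i3)) hpt
    _ = (∫ x, h x * ψ x) + (2 * (∫ x, ‖h x - g x‖) + δ) := by
        have i23 : Integrable fun x => 2 * ‖h x - g x‖ + δ := i2.add i3
        rw [integral_add i1 i23, integral_add i2 i3, integral_const_mul]
        simp
    _ ≤ C + ε := by have := H ψ hψ1; linarith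

lemma continuousLinearMap_eq_zero_of_fourier (L : C(UnitAddCircle, ℂ) →L[ℂ] ℂ)
    (hL : ∀ k : ℤ, L (fourier k) = 0) : L = 0 := by
  refine ContinuousLinearMap.ext_on (s := Set.range (fourier (T := 1))) ?_ ?_
  · rw [Submodule.dense_iff_topologicalClosure_eq_top]
    exact span_fourier_closure_eq_top
  · rintro _ ⟨k, rfl⟩
    simpa using hL k

lemma ae_eq_zero_of_fourier {h : UnitAddCircle → ℝ} (hh : Integrable h)
    (H : ∀ k : ℤ, ∫ x, (h x : ℂ) * fourier k x = 0) : ∀ᵐ x, h x = 0 := by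
  have hi (ψ : C(UnitAddCircle, ℂ)) : Integrable fun x => (h x : ℂ) * ψ x :=
    hh.ofReal.mul_bdd (c := ‖ψ‖) ψ.continuous.aestronglyMeasurable
      (.of_forall ψ.norm_coe_le_norm)
  let L : C(UnitAddCircle, ℂ) →L[ℂ] ℂ := LinearMap.mkContinuous
    { toFun := fun ψ => ∫ x, (h x : ℂ) * ψ x
      map_add' := fun ψ φ => by
        simp only [ContinuousMap.add_apply, mul_add]
        exact integral_add (hi ψ) (hi φ)
      map_smul' := fun c ψ => by
        simp only [ContinuousMap.smul_apply, smul_eq_mul, RingHom.id_apply]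
        rw [← integral_const_mul]; congr 1; ext x; ring }
    (∫ x, ‖h x‖) fun ψ => by
      refine (norm_integral_le_integral_norm _).trans ?_
      rw [← integral_mul_const]
      refine integral_mono (hi ψ).norm (hh.norm.mul_const _) fun x => ?_
      simp only [norm_mul, Complex.norm_real]
      gcongr
      exact ψ.norm_coe_le_norm x
  have hL : L = 0 := continuousLinearMap_eq_zero_of_fourier L H
  have h0 : ∫ x, |h x| ≤ 0 := by
    refine integral_abs_le_of_forall_continuous hh fun ψ _ => ?_
    have h1 : L ⟨fun x => (ψ x : ℂ), by fun_prop⟩ = 0 := by rw [hL]; rfl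
    change ∫ x, (h x : ℂ) * (ψ x : ℂ) = 0 at h1
    simp_rw [← Complex.ofReal_mul] at h1
    rw [integral_complex_ofReal] at h1
    exact (Complex.ofReal_eq_zero.1 h1).le
  have h1 : ∫ x, |h x| = 0 := h0.antisymm (integral_nonneg fun x => abs_nonneg _)
  have h2 := (integral_eq_zero_iff_of_nonneg (fun x => abs_nonneg (h x)) hh.abs).1 h1
  filter_upwards [h2] with x hx
  simpa using hx

/-! ### The average along free flights -/

section FlightAverage

variable {E : Type*} [NormedAddCommGroup E] [NormedSpace ℝ E]

/-- The average `∫₀^∞ e^{-s} ψ(x + s v) ds` of `ψ` along the free flight from `x` with velocity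
`v`, up to an exponential time. It is the bounded solution `φ` of `φ - v ∂ₓ φ = ψ`, the equation
adjoint to `v ∂ₓ f + f = G`. -/
noncomputable def flightAverage (ψ : UnitAddCircle → E) (z : Phase) : E :=
  ∫ s in Set.Ioi (0 : ℝ), Real.exp (-s) • ψ (z.1 + ((s * z.2 : ℝ) : UnitAddCircle))

lemma continuous_flight : Continuous fun y : Phase × ℝ =>
    (y.1.1 + ((y.2 * y.1.2 : ℝ) : UnitAddCircle)) :=
  (continuous_fst.comp continuous_fst).add
    ((AddCircle.continuous_mk' 1).comp (by fun_prop))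

lemma continuous_flight_right (z : Phase) : Continuous fun s : ℝ =>
    (z.1 + ((s * z.2 : ℝ) : UnitAddCircle)) :=
  continuous_flight.comp (by fun_prop : Continuous fun s : ℝ => (z, s))

lemma integrableOn_exp_neg_Ioi : IntegrableOn (fun s : ℝ => Real.exp (-s)) (Set.Ioi 0) := by
  simpa using _root_.integrableOn_exp_neg_Ioi 0

lemma integral_exp_neg_Ioi_one : ∫ s in Set.Ioi (0 : ℝ), Real.exp (-s) = 1 := by
  simpa only [neg_zero, Real.exp_zero] using integral_exp_neg_Ioi 0

lemma integrableOn_flight (ψ : C(UnitAddCircle, E)) (z : Phase) :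
    IntegrableOn (fun s : ℝ => Real.exp (-s) • ψ (z.1 + ((s * z.2 : ℝ) : UnitAddCircle)))
      (Set.Ioi 0) := by
  refine (integrableOn_exp_neg_Ioi.mul_const ‖ψ‖).mono'
    ((Continuous.smul (by fun_prop)
      (ψ.continuous.comp (continuous_flight_right z))).aestronglyMeasurable)
    (.of_forall fun s => ?_)
  rw [norm_smul, Real.norm_eq_abs, Real.abs_exp]
  gcongr
  exact ψ.norm_coe_le_norm _

lemma norm_flightAverage_le (ψ : C(UnitAddCircle, E)) (z : Phase) :
    ‖flightAverage ψ z‖ ≤ ‖ψ‖ := by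
  refine (norm_integral_le_of_norm_le (integrableOn_exp_neg_Ioi.mul_const ‖ψ‖)
    (.of_forall fun s => ?_)).trans ?_
  · rw [norm_smul, Real.norm_eq_abs, Real.abs_exp]
    gcongr
    exact ψ.norm_coe_le_norm _
  · rw [integral_mul_const, integral_exp_neg_Ioi_one, one_mul]

lemma continuous_flightAverage (ψ : C(UnitAddCircle, E)) : Continuous (flightAverage ψ) := by
  refine continuous_of_dominated (bound := fun s => Real.exp (-s) * ‖ψ‖)
    (fun z => (integrableOn_flight ψ z).aestronglyMeasurable)
    (fun z => .of_forall fun s => ?_) (integrableOn_exp_neg_Ioi.mul_const _)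
    (.of_forall fun s => ?_)
  · rw [norm_smul, Real.norm_eq_abs, Real.abs_exp]
    gcongr
    exact ψ.norm_coe_le_norm _
  · exact (ψ.continuous.comp (continuous_flight.comp
      (by fun_prop : Continuous fun z : Phase => (z, s)))).const_smul _

lemma flightAverage_add (ψ φ : C(UnitAddCircle, E)) (z : Phase) :
    flightAverage (ψ + φ : C(UnitAddCircle, E)) z = flightAverage ψ z + flightAverage φ z := by
  simp only [flightAverage, ContinuousMap.add_apply, smul_add]
  exact integral_add (integrableOn_flight ψ z) (integrableOn_flight φ z)

lemma flightAverage_ofReal (ψ : UnitAddCircle → ℝ) (z : Phase) :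
    flightAverage (fun x => (ψ x : ℂ)) z = ((flightAverage ψ z : ℝ) : ℂ) := by
  simp only [flightAverage, Complex.real_smul, smul_eq_mul, ← Complex.ofReal_mul]
  exact integral_complex_ofReal

lemma flightAverage_smul (c : ℂ) (ψ : UnitAddCircle → ℂ) (z : Phase) :
    flightAverage (fun x => c * ψ x) z = c * flightAverage ψ z := by
  simp only [flightAverage]
  rw [← integral_const_mul]
  congr 1; ext s
  simp only [Complex.real_smul]; ring

lemma flightAverage_one (z : Phase) : flightAverage (fun _ => (1 : ℝ)) z = 1 := by
  simp only [flightAverage, smul_eq_mul, mul_one, integral_exp_neg_Ioi_one]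

lemma flightAverage_fourier (k : ℤ) (z : Phase) :
    flightAverage (fourier k : C(UnitAddCircle, ℂ)) z
      = fourier k z.1 / (1 - 2 * Real.pi * Complex.I * k * z.2) := by
  set a : ℂ := -(1 - 2 * Real.pi * Complex.I * k * z.2) with ha
  have hre : a.re < 0 := by simp [ha]
  have h (s : ℝ) : Real.exp (-s) • (fourier k : C(UnitAddCircle, ℂ))
      (z.1 + ((s * z.2 : ℝ) : UnitAddCircle)) = fourier k z.1 * Complex.exp (a * s) := by
    rw [fourier_add_coe, fourier_coe_apply, Complex.real_smul, Complex.ofReal_exp, mul_left_comm,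
      ← Complex.exp_add]
    congr 2
    rw [ha]; push_cast; ring
  simp only [flightAverage, h]
  rw [integral_const_mul, integral_exp_mul_complex_Ioi hre]
  simp only [Complex.ofReal_zero, mul_zero, Complex.exp_zero]
  rw [ha, neg_div_neg_eq, mul_one_div]

lemma integrable_mul_flightAverage {F : Phase → ℝ} (hF : Integrable F)
    (ψ : C(UnitAddCircle, ℝ)) : Integrable fun z => F z * flightAverage ψ z :=
  hF.mul_bdd (c := ‖ψ‖) (continuous_flightAverage ψ).aestronglyMeasurable
    (.of_forall (norm_flightAverage_le ψ))

/-- By density of the trigonometric polynomials, an identity that is linear in the test function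
extends from characters to all continuous functions. -/
lemma integral_mul_eq_flightAverage_of_fourier {F G : Phase → ℝ} (hF : Integrable F)
    (hG : Integrable G)
    (H : ∀ k : ℤ, ∫ z, (F z : ℂ) * fourier k z.1
      = ∫ z, (G z : ℂ) * flightAverage (fourier k : C(UnitAddCircle, ℂ)) z)
    (ψ : C(UnitAddCircle, ℝ)) : ∫ z, F z * ψ z.1 = ∫ z, G z * flightAverage ψ z := by
  have iF (ψ : C(UnitAddCircle, ℂ)) : Integrable fun z : Phase => (F z : ℂ) * ψ z.1 :=
    hF.ofReal.mul_bdd (c := ‖ψ‖) (ψ.continuous.comp continuous_fst).aestronglyMeasurable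
      (.of_forall fun z => ψ.norm_coe_le_norm z.1)
  have iG (ψ : C(UnitAddCircle, ℂ)) : Integrable fun z : Phase =>
      (G z : ℂ) * flightAverage ψ z :=
    hG.ofReal.mul_bdd (c := ‖ψ‖) (continuous_flightAverage ψ).aestronglyMeasurable
      (.of_forall fun z => norm_flightAverage_le ψ z)
  let L : C(UnitAddCircle, ℂ) →L[ℂ] ℂ := LinearMap.mkContinuous
    { toFun := fun ψ => (∫ z, (F z : ℂ) * ψ z.1) - ∫ z, (G z : ℂ) * flightAverage ψ z
      map_add' := fun ψ φ => by
        simp only [flightAverage_add, ContinuousMap.add_apply, mul_add]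
        rw [integral_add (iF ψ) (iF φ), integral_add (iG ψ) (iG φ)]
        ring
      map_smul' := fun c ψ => by
        simp only [ContinuousMap.coe_smul, RingHom.id_apply]
        have h1 (z : Phase) : flightAverage (c • ⇑ψ) z = c * flightAverage ψ z :=
          flightAverage_smul c ψ z
        simp only [h1, Pi.smul_apply, smul_eq_mul, mul_left_comm _ c]
        rw [integral_const_mul, integral_const_mul]; ring }
    ((∫ z, ‖F z‖) + ∫ z, ‖G z‖) fun ψ => by
      refine (norm_sub_le _ _).trans ?_
      rw [add_mul, ← integral_mul_const, ← integral_mul_const]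
      refine add_le_add ((norm_integral_le_integral_norm _).trans ?_)
        ((norm_integral_le_integral_norm _).trans ?_)
      · refine integral_mono (iF ψ).norm (hF.norm.mul_const _) fun z => ?_
        simp only [norm_mul, Complex.norm_real]
        gcongr
        exact ψ.norm_coe_le_norm _
      · refine integral_mono (iG ψ).norm (hG.norm.mul_const _) fun z => ?_
        simp only [norm_mul, Complex.norm_real]
        gcongr
        exact norm_flightAverage_le ψ z
  have hL : L = 0 := continuousLinearMap_eq_zero_of_fourier L fun k => sub_eq_zero.2 (H k)
  have h1 : L ⟨fun x => (ψ x : ℂ), by fun_prop⟩ = 0 := by rw [hL]; rfl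
  have h2 : (∫ z : Phase, (F z : ℂ) * (ψ z.1 : ℂ))
      = ∫ z, (G z : ℂ) * flightAverage (fun x => (ψ x : ℂ)) z := sub_eq_zero.1 h1
  simp only [flightAverage_ofReal, ← Complex.ofReal_mul] at h2
  rw [integral_complex_ofReal, integral_complex_ofReal] at h2
  exact_mod_cast h2

/-- Flights with time in `[1, 2]` and velocity in `[0, 1]` cover the circle, so that they alone
bound the averaged flight from below by a multiple of the mean of `ψ`. -/
lemma integral_mul_flightAverage_ge {R : ℝ → ℝ} (hR : Integrable R) (hR0 : ∀ v, 0 ≤ R v)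
    {r : ℝ} (hr : 0 ≤ r) (hRr : ∀ v, 0 ≤ v → v ≤ 1 → r ≤ R v) (ψ : C(UnitAddCircle, ℝ))
    (hψ : ∀ x, 0 ≤ ψ x) (x : UnitAddCircle) :
    r * (Real.exp (-2) / 2) * ∫ y, ψ y ≤ ∫ v, R v * flightAverage ψ (x, v) := by
  set m := ∫ y, ψ y with hm
  have hcont : Continuous fun y : ℝ × ℝ => ψ (x + ((y.2 * y.1 : ℝ) : UnitAddCircle)) :=
    ψ.continuous.comp (continuous_flight.comp
      (by fun_prop : Continuous fun y : ℝ × ℝ => (((x, y.1) : Phase), y.2)))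
  -- one flight time: rescaling `u = s v` sweeps an interval of length `s ≥ 1`
  have hflight (s : ℝ) (hs : s ∈ Set.Icc (1 : ℝ) 2) :
      m / 2 ≤ ∫ v in (0 : ℝ)..1, ψ (x + ((s * v : ℝ) : UnitAddCircle)) := by
    have hs1 := hs.1
    have hs2 := hs.2
    have hc : Continuous fun u : ℝ => ψ (x + (u : UnitAddCircle)) :=
      ψ.continuous.comp (continuous_const.add (AddCircle.continuous_mk' 1))
    rw [intervalIntegral.integral_comp_mul_left (fun u : ℝ => ψ (x + (u : UnitAddCircle)))
      (by linarith : s ≠ 0)]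
    have h1 : m = ∫ u in (0 : ℝ)..1, ψ (x + (u : UnitAddCircle)) := by
      have := UnitAddCircle.intervalIntegral_preimage 0 fun y => ψ (x + y)
      rw [zero_add] at this
      rw [this, hm, integral_add_left_eq_self (fun y => ψ y) x]
    have h2 : m ≤ ∫ u in (s * 0)..(s * 1), ψ (x + (u : UnitAddCircle)) := by
      rw [h1]
      exact intervalIntegral.integral_mono_interval (by simp) (by norm_num) (by linarith)
        (.of_forall fun u => hψ _) (hc.intervalIntegrable _ _)
    have hm0 : 0 ≤ m := integral_nonneg hψ
    rw [smul_eq_mul, inv_mul_eq_div, div_le_div_iff₀ (by norm_num) (by linarith)]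
    nlinarith
  have hA (v : ℝ) : ∫ s in (1 : ℝ)..2, Real.exp (-s) * ψ (x + ((s * v : ℝ) : UnitAddCircle))
      ≤ flightAverage ψ (x, v) := by
    rw [intervalIntegral.integral_of_le (by norm_num)]
    refine setIntegral_mono_set (integrableOn_flight ψ (x, v)) (.of_forall fun s => ?_)
      (LE.le.eventuallyLE fun s hs => lt_trans one_pos hs.1)
    exact mul_nonneg (Real.exp_pos _).le (hψ _)
  have hA0 (v : ℝ) : 0 ≤ flightAverage ψ (x, v) :=
    integral_nonneg fun s => by
      simp only [smul_eq_mul]; exact mul_nonneg (Real.exp_pos _).le (hψ _)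
  have hJ : Continuous fun y : ℝ × ℝ =>
      Real.exp (-y.2) * ψ (x + ((y.2 * y.1 : ℝ) : UnitAddCircle)) :=
    Continuous.mul (by fun_prop) hcont
  have hAc : Continuous fun v : ℝ => flightAverage ψ (x, v) :=
    (continuous_flightAverage ψ).comp (by fun_prop)
  have hRA : Integrable fun v => R v * flightAverage ψ (x, v) :=
    hR.mul_bdd (c := ‖ψ‖) hAc.aestronglyMeasurable (.of_forall fun v => norm_flightAverage_le ψ _)
  calc r * (Real.exp (-2) / 2) * m
      = r * ∫ s in (1 : ℝ)..2, Real.exp (-2) * (m / 2) := by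
        rw [intervalIntegral.integral_const, smul_eq_mul]; ring
    _ ≤ r * ∫ s in (1 : ℝ)..2, ∫ v in (0 : ℝ)..1,
          Real.exp (-s) * ψ (x + ((s * v : ℝ) : UnitAddCircle)) := by
        gcongr
        refine intervalIntegral.integral_mono_on (by norm_num) (by simp) ?_ fun s hs => ?_
        · refine Continuous.intervalIntegrable ?_ _ _
          exact intervalIntegral.continuous_parametric_intervalIntegral_of_continuous'
            (f := fun s v => Real.exp (-s) * ψ (x + ((s * v : ℝ) : UnitAddCircle)))
            (hJ.comp continuous_swap) _ _
        · rw [intervalIntegral.integral_const_mul]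
          have hm0 : 0 ≤ m := integral_nonneg hψ
          gcongr
          · linarith [hs.2]
          · exact hflight s hs
    _ = r * ∫ v in (0 : ℝ)..1, ∫ s in (1 : ℝ)..2,
          Real.exp (-s) * ψ (x + ((s * v : ℝ) : UnitAddCircle)) := by
        congr 1
        simp only [intervalIntegral.integral_of_le zero_le_one,
          intervalIntegral.integral_of_le one_le_two]
        refine integral_integral_swap ?_
        rw [Measure.prod_restrict]
        exact ((hJ.comp continuous_swap).continuousOn.integrableOn_compact
          (isCompact_Icc.prod isCompact_Icc)).mono_set
          (Set.prod_mono Set.Ioc_subset_Icc_self Set.Ioc_subset_Icc_self)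
    _ ≤ r * ∫ v in (0 : ℝ)..1, flightAverage ψ (x, v) := by
        gcongr
        refine intervalIntegral.integral_mono_on (by norm_num) ?_ (hAc.intervalIntegrable _ _)
          fun v _ => hA v
        exact Continuous.intervalIntegrable
          (intervalIntegral.continuous_parametric_intervalIntegral_of_continuous' hJ _ _) _ _
    _ ≤ ∫ v in (0 : ℝ)..1, R v * flightAverage ψ (x, v) := by
        rw [← intervalIntegral.integral_const_mul]
        refine intervalIntegral.integral_mono_on (by norm_num)
          ((hAc.intervalIntegrable _ _).const_mul _) hRA.intervalIntegrable fun v hv => ?_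
        exact mul_le_mul_of_nonneg_right (hRr v hv.1 hv.2) (hA0 v)
    _ ≤ ∫ v, R v * flightAverage ψ (x, v) := by
        rw [intervalIntegral.integral_of_le (by norm_num)]
        exact setIntegral_le_integral hRA (.of_forall fun v => mul_nonneg (hR0 v) (hA0 v))

/-- Doeblin's argument: the mean of `ψ` can be split off the averaged flight, and what is left
is smaller than `ψ` by a fixed factor. -/
lemma abs_integral_mul_flightAverage_sub_le {R : ℝ → ℝ} (hR : Integrable R)
    (hR0 : ∀ v, 0 ≤ R v) (hR1 : ∫ v, R v = 1)
    {r : ℝ} (hr : 0 ≤ r) (hRr : ∀ v, 0 ≤ v → v ≤ 1 → r ≤ R v) (ψ : C(UnitAddCircle, ℝ))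
    (hψ : ∀ x, |ψ x| ≤ 1) (x : UnitAddCircle) :
    |(∫ v, R v * flightAverage ψ (x, v)) - r * (Real.exp (-2) / 2) * ∫ y, ψ y|
      ≤ 1 - r * (Real.exp (-2) / 2) := by
  have hi (ψ : C(UnitAddCircle, ℝ)) : Integrable fun v => R v * flightAverage ψ (x, v) :=
    hR.mul_bdd (c := ‖ψ‖) (((continuous_flightAverage ψ).comp
      (by fun_prop : Continuous fun v : ℝ => ((x, v) : Phase))).aestronglyMeasurable)
      (.of_forall fun v => norm_flightAverage_le ψ _)
  have iψ : Integrable ψ := ψ.continuous.integrable_of_hasCompactSupport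
    (HasCompactSupport.of_compactSpace _)
  have hneg (z : Phase) : flightAverage (-ψ : C(UnitAddCircle, ℝ)) z = -flightAverage ψ z := by
    simp only [flightAverage, ContinuousMap.neg_apply, smul_neg, integral_neg]
  have hone (z : Phase) : flightAverage (1 : C(UnitAddCircle, ℝ)) z = 1 := flightAverage_one z
  have h1 := integral_mul_flightAverage_ge hR hR0 hr hRr (1 + ψ)
    (fun x => by have := (abs_le.1 (hψ x)).1; simp; linarith) x
  have h2 := integral_mul_flightAverage_ge hR hR0 hr hRr (1 + -ψ)
    (fun x => by have := (abs_le.1 (hψ x)).2; simp; linarith) x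
  simp only [flightAverage_add, hneg, hone, mul_add, mul_one, mul_neg, ContinuousMap.add_apply,
    ContinuousMap.one_apply, ContinuousMap.neg_apply] at h1 h2
  rw [integral_add hR (hi ψ), integral_add (integrable_const _) iψ, hR1] at h1
  simp only [← sub_eq_add_neg] at h2
  rw [integral_sub hR (hi ψ), integral_sub (integrable_const _) iψ, hR1] at h2
  simp only [integral_const, probReal_univ, smul_eq_mul, mul_one] at h1 h2
  rw [abs_le]
  constructor <;> linarith

end FlightAverage

/-! ### The Fourier transform in position of the weak equation -/

/-- The test function `Re (c e^{2πikx}) χ(v)`. -/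
noncomputable def waveTest (c : ℂ) (k : ℤ) (χ : ℝ → ℝ) (z : Phase) : ℝ :=
  (c * fourier k z.1).re * χ z.2

lemma isTest_waveTest (c : ℂ) (k : ℤ) {χ : ℝ → ℝ} (hχ : ContDiff ℝ ∞ χ)
    (hc : HasCompactSupport χ) : IsTest (waveTest c k χ) := by
  constructor
  · simp only [waveTest, fourier_coe_apply]
    refine ContDiff.mul ?_ (hχ.comp contDiff_snd)
    refine Complex.reCLM.contDiff.comp (contDiff_const.mul (ContDiff.cexp ?_))
    refine (contDiff_const.mul (Complex.ofRealCLM.contDiff.comp contDiff_fst)).div_const _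
  · refine HasCompactSupport.intro (isCompact_univ.prod hc.isCompact) fun z hz => ?_
    have : χ z.2 = 0 := image_eq_zero_of_notMem_tsupport fun h => hz ⟨Set.mem_univ _, h⟩
    simp [waveTest, this]

lemma dx_waveTest (c : ℂ) (k : ℤ) (χ : ℝ → ℝ) (z : Phase) :
    dx (waveTest c k χ) z = waveTest (c * (2 * Real.pi * Complex.I * k)) k χ z := by
  have h := (Complex.reCLM.hasFDerivAt.comp_hasDerivAt 0
    ((hasDerivAt_fourier 1 k 0).const_mul (c * fourier k z.1))).mul_const (χ z.2)
  have h1 : (fun s : ℝ => waveTest c k χ (z.1 + (s : UnitAddCircle), z.2)) = fun s : ℝ =>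
      Complex.reCLM (c * fourier k z.1 * fourier k (s : UnitAddCircle)) * χ z.2 := by
    ext s
    simp only [waveTest, fourier_add_coe, Complex.reCLM_apply, mul_assoc]
  rw [dx, h1]
  refine h.deriv.trans ?_
  simp only [waveTest, Complex.reCLM_apply, AddCircle.coe_zero, fourier_eval_zero]
  congr 2
  push_cast
  ring

lemma mul_waveTest (a : ℝ) (c : ℂ) (k : ℤ) (χ : ℝ → ℝ) (z : Phase) :
    a * waveTest c k χ z = (c * ((χ z.2 : ℂ) * (fourier k z.1 * a))).re := by
  have : c * ((χ z.2 : ℂ) * (fourier k z.1 * a)) = ((a * χ z.2 : ℝ) : ℂ) * (c * fourier k z.1) := by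
    push_cast; ring
  rw [this, Complex.re_ofReal_mul, waveTest]
  ring

variable {T₁ T₂ α : ℝ} {f : Phase → ℝ}

/-- The integrand of the `k`-th Fourier mode in position of `G - f - v ∂ₓ f`, with `∂ₓ` moved to
the character by parts. The character is `e^{2πikx}`, not its conjugate, hence the sign in
`1 - 2πikv`. -/
noncomputable def modeDefect (f G : Phase → ℝ) (k : ℤ) (z : Phase) : ℂ :=
  fourier k z.1 * (G z - (1 - 2 * Real.pi * Complex.I * k * z.2) * f z)

lemma integrable_fourier_mul {F : Phase → ℝ} (hF : Integrable F) (k : ℤ) :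
    Integrable fun z : Phase => (fourier k z.1 : ℂ) * F z :=
  hF.ofReal.bdd_mul (c := 1) ((fourier k).continuous.comp continuous_fst).aestronglyMeasurable
    (.of_forall fun z => by simp only [fourier_apply, Circle.norm_coe, le_refl])

lemma modeDefect_eq (f G : Phase → ℝ) (k : ℤ) (z : Phase) :
    modeDefect f G k z = fourier k z.1 * G z - fourier k z.1 * f z
      + 2 * Real.pi * Complex.I * k * (fourier k z.1 * (z.2 * f z : ℝ)) := by
  rw [modeDefect]; push_cast; ring

namespace IsSteadyState

lemma integrable_mul (hf : IsSteadyState T₁ T₂ α f) : Integrable fun z : Phase => z.2 * f z :=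
  integrable_mul_of_integrable_sq_mul measurable_snd hf.integrable hf.second_moment

lemma integrable_modeDefect (hf : IsSteadyState T₁ T₂ α f)
    (hG : Integrable (gain T₁ T₂ α f)) (k : ℤ) :
    Integrable (modeDefect f (gain T₁ T₂ α f) k) := by
  rw [funext (modeDefect_eq _ _ k)]
  exact ((integrable_fourier_mul hG k).sub (integrable_fourier_mul hf.integrable k)).add
    ((integrable_fourier_mul hf.integrable_mul k).const_mul _)

lemma integral_modeDefect_mul_test (hf : IsSteadyState T₁ T₂ α f)
    (hG : Integrable (gain T₁ T₂ α f)) (k : ℤ) {χ : ℝ → ℝ} (hχ : ContDiff ℝ ∞ χ)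
    (hc : HasCompactSupport χ) :
    ∫ z : Phase, (χ z.2 : ℂ) * modeDefect f (gain T₁ T₂ α f) k z = 0 := by
  -- real test functions `Re (c e^{2πikx}) χ(v)` with `c = 1` and `c = -i` give both parts
  obtain ⟨B, hB⟩ := hc.exists_bound_of_continuous hχ.continuous
  have hχm : AEStronglyMeasurable (fun z : Phase => (χ z.2 : ℂ)) :=
    (Complex.continuous_ofReal.comp (hχ.continuous.comp continuous_snd)).aestronglyMeasurable
  have hχb : ∀ᵐ z : Phase, ‖(χ z.2 : ℂ)‖ ≤ B := .of_forall fun z => by simpa using hB z.2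
  have hi : Integrable fun z : Phase => (χ z.2 : ℂ) * modeDefect f (gain T₁ T₂ α f) k z :=
    (hf.integrable_modeDefect hG k).bdd_mul hχm hχb
  have key (c : ℂ) :
      (c * ∫ z : Phase, (χ z.2 : ℂ) * modeDefect f (gain T₁ T₂ α f) k z).re = 0 := by
    have hw := hf.weak_eq _ (isTest_waveTest c k hχ hc)
    have i1 : Integrable fun z : Phase => z.2 * f z * dx (waveTest c k χ) z := by
      simp only [dx_waveTest, mul_waveTest]
      exact (((integrable_fourier_mul hf.integrable_mul k).bdd_mul hχm hχb).const_mul _).re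
    have i2 : Integrable fun z : Phase =>
        (gain T₁ T₂ α f z - f z) * waveTest c k χ z := by
      simp only [mul_waveTest]
      exact (((integrable_fourier_mul (hG.sub hf.integrable) k).bdd_mul hχm hχb).const_mul _).re
    rw [neg_eq_iff_add_eq_zero, ← integral_add i1 i2] at hw
    rw [← integral_const_mul, ← Complex.reCLM_apply, ← ContinuousLinearMap.integral_comp_comm _
      (hi.const_mul c), ← hw]
    congr 1; ext z
    rw [dx_waveTest, modeDefect_eq, mul_waveTest, mul_waveTest, ← Complex.add_re,
      Complex.reCLM_apply]
    congr 1
    push_cast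
    ring
  have h1 := key 1
  have h2 := key (-Complex.I)
  apply Complex.ext
  · simpa using h1
  · simpa using h2

/-- In Fourier variables the stationary transport equation is algebraic in `v`. -/
lemma ae_integral_modeDefect (hf : IsSteadyState T₁ T₂ α f)
    (hG : Integrable (gain T₁ T₂ α f)) (k : ℤ) :
    ∀ᵐ v : ℝ, ∫ x, modeDefect f (gain T₁ T₂ α f) k (x, v) = 0 := by
  have hi := hf.integrable_modeDefect hG k
  refine ae_eq_zero_of_integral_contDiff_smul_eq_zero hi.integral_prod_right.locallyIntegrable
    fun χ hχ hc => ?_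
  obtain ⟨B, hB⟩ := hc.exists_bound_of_continuous hχ.continuous
  have h := hf.integral_modeDefect_mul_test hG k hχ hc
  rw [Measure.volume_eq_prod, integral_prod_symm] at h
  · simpa only [integral_const_mul, Complex.real_smul] using h
  · exact hi.bdd_mul (c := B) (Complex.continuous_ofReal.comp
      (hχ.continuous.comp continuous_snd)).aestronglyMeasurable
      (.of_forall fun z => by simpa using hB z.2)

/-- The multiplier `w(v)` need not be a test function: `w = 1`, `v`, `v²` give the moment
identities, and `w = (1 - 2πikv)⁻¹` solves for `f`. -/
lemma integral_mul_modeDefect (hf : IsSteadyState T₁ T₂ α f)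
    (hG : Integrable (gain T₁ T₂ α f)) (k : ℤ) {w : ℝ → ℂ}
    (hw : Integrable fun z : Phase => w z.2 * modeDefect f (gain T₁ T₂ α f) k z) :
    ∫ z : Phase, w z.2 * modeDefect f (gain T₁ T₂ α f) k z = 0 := by
  rw [Measure.volume_eq_prod, integral_prod_symm _ hw]
  refine integral_eq_zero_of_ae ?_
  filter_upwards [hf.ae_integral_modeDefect hG k] with v hv
  simp only [integral_const_mul, hv, mul_zero, Pi.zero_apply]

end IsSteadyState

/-! ### Velocity moments of the gain term -/

namespace IsSteadyState

lemma integrable_density (hf : IsSteadyState T₁ T₂ α f) : Integrable (density f) :=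
  hf.integrable.integral_prod_left

lemma integrable_pressure (hf : IsSteadyState T₁ T₂ α f) : Integrable (pressure f) :=
  hf.second_moment.integral_prod_left

lemma integral_density (hf : IsSteadyState T₁ T₂ α f) : ∫ x, density f x = 1 := by
  have h := hf.mass_one
  rw [Measure.volume_eq_prod, integral_prod _ hf.integrable] at h
  exact h

lemma ae_density_nonneg (hf : IsSteadyState T₁ T₂ α f) : ∀ᵐ x, 0 ≤ density f x := by
  filter_upwards [Measure.ae_ae_of_ae_prod hf.nonneg] with x hx
  exact integral_nonneg_of_ae hx

lemma ae_pressure_nonneg (hf : IsSteadyState T₁ T₂ α f) : ∀ᵐ x, 0 ≤ pressure f x := by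
  filter_upwards [Measure.ae_ae_of_ae_prod hf.nonneg] with x hx
  refine integral_nonneg_of_ae ?_
  filter_upwards [hx] with v hv
  exact mul_nonneg (sq_nonneg v) hv

/-- A velocity profile has zero mass if and only if it has zero second moment. -/
lemma ae_density_eq_zero_iff (hf : IsSteadyState T₁ T₂ α f) :
    ∀ᵐ x, density f x = 0 ↔ pressure f x = 0 := by
  filter_upwards [Measure.ae_ae_of_ae_prod hf.nonneg, hf.integrable.prod_right_ae,
    hf.second_moment.prod_right_ae] with x hx hi hi2
  have h2 : 0 ≤ᵐ[volume] fun v => v ^ 2 * f (x, v) := by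
    filter_upwards [hx] with v hv
    exact mul_nonneg (sq_nonneg v) hv
  rw [density, pressure, integral_eq_zero_iff_of_nonneg_ae hx hi,
    integral_eq_zero_iff_of_nonneg_ae h2 hi2]
  constructor <;> intro h
  · filter_upwards [h] with v hv
    simp_all
  · filter_upwards [h, Measure.ae_ne volume 0] with v hv hv0
    simpa [hv0] using hv

lemma aestronglyMeasurable_localMaxwellian (hf : IsSteadyState T₁ T₂ α f) :
    AEStronglyMeasurable (localMaxwellian f) volume := by
  have hρ := hf.integrable_density.aestronglyMeasurable.aemeasurable
  have hP := hf.integrable_pressure.aestronglyMeasurable.aemeasurable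
  have hT : AEMeasurable (temperature f) volume := hP.div hρ
  have h1 : AEMeasurable (fun z : Phase => density f z.1) volume :=
    hρ.comp_quasiMeasurePreserving Measure.quasiMeasurePreserving_fst
  have h2 : AEMeasurable (fun z : Phase => temperature f z.1) volume :=
    hT.comp_quasiMeasurePreserving Measure.quasiMeasurePreserving_fst
  exact (h1.mul (measurable_maxwellian.comp_aemeasurable
    (h2.prodMk measurable_snd.aemeasurable))).aestronglyMeasurable

lemma aestronglyMeasurable_gain (hf : IsSteadyState T₁ T₂ α f) :
    AEStronglyMeasurable (gain T₁ T₂ α f) volume := by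
  have h1 : AEStronglyMeasurable (fun z : Phase => density f z.1) volume :=
    hf.integrable_density.aestronglyMeasurable.comp_quasiMeasurePreserving
      Measure.quasiMeasurePreserving_fst
  exact (hf.aestronglyMeasurable_localMaxwellian.const_mul α).add ((h1.const_mul (1 - α)).mul
    (measurable_reservoir.comp measurable_snd).aestronglyMeasurable)

/-- The gain term preserves the density. Its local Maxwellian part preserves the pressure, whereas
the reservoirs impose the temperature `(T₁ + T₂) / 2`. Positivity of the temperature where
`ρ_f > 0` matters, because `maxwellian 0 = 0` does not have unit mass. -/
lemma ae_gain_section (hf : IsSteadyState T₁ T₂ α f) (h₁ : 0 < T₁) (h₂ : 0 < T₂) :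
    ∀ᵐ x, Integrable (fun v => gain T₁ T₂ α f (x, v)) ∧
      Integrable (fun v => v ^ 2 * gain T₁ T₂ α f (x, v)) ∧
      ∫ v, gain T₁ T₂ α f (x, v) = density f x ∧
      ∫ v, v ^ 2 * gain T₁ T₂ α f (x, v)
        = α * pressure f x + (1 - α) * ((T₁ + T₂) / 2) * density f x := by
  filter_upwards [hf.ae_density_nonneg, hf.ae_pressure_nonneg, hf.ae_density_eq_zero_iff]
    with x hρ hP hiff
  have hT : 0 ≤ temperature f x := div_nonneg hP hρ
  have i1 := ((integrable_maxwellian hT).const_mul (density f x)).const_mul α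
  have i2 := (integrable_reservoir h₁ h₂).const_mul ((1 - α) * density f x)
  have j1 := ((integrable_sq_mul_maxwellian hT).const_mul (density f x)).const_mul α
  have j2 := (integrable_sq_mul_reservoir h₁ h₂).const_mul ((1 - α) * density f x)
  have hsq (v : ℝ) : v ^ 2 * gain T₁ T₂ α f (x, v)
      = α * (density f x * (v ^ 2 * maxwellian (temperature f x) v))
        + (1 - α) * density f x * (v ^ 2 * reservoir T₁ T₂ v) := by
    simp only [gain, localMaxwellian]; ring
  have hm0 : density f x * (∫ v, maxwellian (temperature f x) v) = density f x := by
    rcases hρ.eq_or_lt with h | h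
    · simp [← h]
    · have : 0 < pressure f x := lt_of_le_of_ne hP fun h' => h.ne' (hiff.2 h'.symm)
      rw [temperature, integral_maxwellian (div_pos this h), mul_one]
  have hm2 : density f x * temperature f x = pressure f x := by
    rcases hρ.eq_or_lt with h | h
    · rw [hiff.1 h.symm, ← h, zero_mul]
    · rw [temperature]; field_simp
  refine ⟨i1.add i2, ?_, ?_, ?_⟩
  · simp only [hsq]; exact j1.add j2
  · simp only [gain, localMaxwellian]
    rw [integral_add i1 i2, integral_const_mul, integral_const_mul, integral_const_mul, hm0,
      integral_reservoir h₁ h₂]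
    ring
  · simp only [hsq]
    rw [integral_add j1 j2, integral_const_mul, integral_const_mul, integral_const_mul,
      integral_sq_mul_maxwellian hT, hm2, integral_sq_mul_reservoir h₁ h₂]
    ring

lemma ae_gain_nonneg (hf : IsSteadyState T₁ T₂ α f) (hα0 : 0 ≤ α) (hα1 : α ≤ 1) :
    ∀ᵐ x, ∀ v, 0 ≤ gain T₁ T₂ α f (x, v) := by
  filter_upwards [hf.ae_density_nonneg] with x hρ v
  have h1 := maxwellian_nonneg (temperature f x) v
  have h2 := reservoir_nonneg (T₁ := T₁) (T₂ := T₂) v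
  have h3 : 0 ≤ 1 - α := by linarith
  simp only [gain, localMaxwellian]
  positivity

lemma integrable_gain (hf : IsSteadyState T₁ T₂ α f) (h₁ : 0 < T₁) (h₂ : 0 < T₂)
    (hα0 : 0 ≤ α) (hα1 : α ≤ 1) : Integrable (gain T₁ T₂ α f) := by
  have hs := hf.ae_gain_section h₁ h₂
  refine (integrable_prod_iff hf.aestronglyMeasurable_gain).2
    ⟨hs.mono fun x hx => hx.1, hf.integrable_density.congr ?_⟩
  filter_upwards [hs, hf.ae_gain_nonneg hα0 hα1] with x hx hx0
  simp only [Real.norm_of_nonneg (hx0 _), hx.2.2.1]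

lemma integrable_sq_mul_gain (hf : IsSteadyState T₁ T₂ α f) (h₁ : 0 < T₁) (h₂ : 0 < T₂)
    (hα0 : 0 ≤ α) (hα1 : α ≤ 1) :
    Integrable fun z : Phase => z.2 ^ 2 * gain T₁ T₂ α f z := by
  have hs := hf.ae_gain_section h₁ h₂
  refine (integrable_prod_iff ((by fun_prop :
    Measurable fun z : Phase => z.2 ^ 2).aestronglyMeasurable.mul hf.aestronglyMeasurable_gain)).2
    ⟨hs.mono fun x hx => hx.2.1, ((hf.integrable_pressure.const_mul α).add
      (hf.integrable_density.const_mul ((1 - α) * ((T₁ + T₂) / 2)))).congr ?_⟩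
  filter_upwards [hs, hf.ae_gain_nonneg hα0 hα1] with x hx hx0
  have h (v : ℝ) : ‖v ^ 2 * gain T₁ T₂ α f (x, v)‖ = v ^ 2 * gain T₁ T₂ α f (x, v) :=
    Real.norm_of_nonneg (mul_nonneg (sq_nonneg _) (hx0 _))
  simp only [Pi.add_apply, Pi.mul_apply, h, hx.2.2.2]

lemma integral_mul_gain_section (x : UnitAddCircle) : ∫ v, v * gain T₁ T₂ α f (x, v) = 0 :=
  integral_mul_even fun v => by simp [gain, localMaxwellian, maxwellian_neg, reservoir_neg]

end IsSteadyState

lemma integral_fourier_mul {F : Phase → ℝ} (hF : Integrable F) (k : ℤ) :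
    ∫ z : Phase, (fourier k z.1 : ℂ) * F z
      = ∫ x, (fourier k x : ℂ) * ((∫ v, F (x, v) : ℝ) : ℂ) := by
  rw [Measure.volume_eq_prod, integral_prod _ (integrable_fourier_mul hF k)]
  simp only [integral_const_mul, integral_complex_ofReal]

namespace IsSteadyState

/-! ### Conservation laws: the pressure is constant -/

lemma integral_fourier_mul_velocity_eq_zero (hf : IsSteadyState T₁ T₂ α f) (h₁ : 0 < T₁)
    (h₂ : 0 < T₂) (hα0 : 0 ≤ α) (hα1 : α ≤ 1) {k : ℤ} (hk : k ≠ 0) :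
    ∫ z : Phase, (fourier k z.1 : ℂ) * (z.2 * f z : ℝ) = 0 := by
  have hG := hf.integrable_gain h₁ h₂ hα0 hα1
  have h := hf.integral_mul_modeDefect hG k (w := fun _ => 1)
    (by simpa using hf.integrable_modeDefect hG k)
  have iG := integrable_fourier_mul hG k
  have i0 := integrable_fourier_mul hf.integrable k
  have i1 := integrable_fourier_mul hf.integrable_mul k
  simp only [one_mul, modeDefect_eq] at h
  have iG0 := iG.sub i0
  simp only [Pi.sub_def] at iG0
  rw [integral_add iG0 (i1.const_mul _), integral_sub iG i0, integral_const_mul,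
    integral_fourier_mul hG, integral_fourier_mul hf.integrable] at h
  have hρ : ∫ x, (fourier k x : ℂ) * ((∫ v, gain T₁ T₂ α f (x, v) : ℝ) : ℂ)
      = ∫ x, (fourier k x : ℂ) * ((∫ v, f (x, v) : ℝ) : ℂ) := by
    refine integral_congr_ae ?_
    filter_upwards [hf.ae_gain_section h₁ h₂] with x hx
    simp only [hx.2.2.1, density]
  rw [hρ, sub_self, zero_add] at h
  simpa [hk, Real.pi_ne_zero, Complex.I_ne_zero] using h

lemma integral_fourier_mul_pressure (hf : IsSteadyState T₁ T₂ α f) (h₁ : 0 < T₁)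
    (h₂ : 0 < T₂) (hα0 : 0 ≤ α) (hα1 : α ≤ 1) {k : ℤ} (hk : k ≠ 0) :
    ∫ x, (fourier k x : ℂ) * (pressure f x : ℂ) = 0 := by
  have hG := hf.integrable_gain h₁ h₂ hα0 hα1
  have hG1 : Integrable fun z : Phase => z.2 * gain T₁ T₂ α f z :=
    integrable_mul_of_integrable_sq_mul measurable_snd hG
      (hf.integrable_sq_mul_gain h₁ h₂ hα0 hα1)
  have iG := integrable_fourier_mul hG1 k
  have i1 := integrable_fourier_mul hf.integrable_mul k
  have i2 := integrable_fourier_mul hf.second_moment k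
  have hY (z : Phase) : (z.2 : ℂ) * modeDefect f (gain T₁ T₂ α f) k z
      = fourier k z.1 * (z.2 * gain T₁ T₂ α f z : ℝ) - fourier k z.1 * (z.2 * f z : ℝ)
        + 2 * Real.pi * Complex.I * k * (fourier k z.1 * (z.2 ^ 2 * f z : ℝ)) := by
    rw [modeDefect_eq]; push_cast; ring
  have h := hf.integral_mul_modeDefect hG k (w := fun v => v)
    (by simp only [hY]; exact (iG.sub i1).add (i2.const_mul _))
  simp only [hY] at h
  have iG1 := iG.sub i1
  simp only [Pi.sub_def] at iG1
  rw [integral_add iG1 (i2.const_mul _), integral_sub iG i1, integral_const_mul,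
    hf.integral_fourier_mul_velocity_eq_zero h₁ h₂ hα0 hα1 hk, integral_fourier_mul hG1,
    integral_fourier_mul hf.second_moment] at h
  simp only [integral_mul_gain_section] at h
  simpa [hk, Real.pi_ne_zero, Complex.I_ne_zero, pressure] using h

lemma integral_pressure (hf : IsSteadyState T₁ T₂ α f) (h₁ : 0 < T₁)
    (h₂ : 0 < T₂) (hα0 : 0 ≤ α) (hα1 : α < 1) :
    ∫ x, pressure f x = (T₁ + T₂) / 2 := by
  have hG := hf.integrable_gain h₁ h₂ hα0 hα1.le
  have hG2 := hf.integrable_sq_mul_gain h₁ h₂ hα0 hα1.le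
  have hY (z : Phase) : ((z.2 : ℂ) ^ 2) * modeDefect f (gain T₁ T₂ α f) 0 z
      = ((z.2 ^ 2 * gain T₁ T₂ α f z - z.2 ^ 2 * f z : ℝ) : ℂ) := by
    rw [modeDefect_eq]; push_cast; simp; ring
  have h := hf.integral_mul_modeDefect hG 0 (w := fun v => (v : ℂ) ^ 2)
    (by simp only [hY]; exact (hG2.sub hf.second_moment).ofReal)
  simp only [hY] at h
  rw [integral_complex_ofReal, Complex.ofReal_eq_zero, integral_sub hG2 hf.second_moment,
    Measure.volume_eq_prod, integral_prod _ hG2, integral_prod _ hf.second_moment] at h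
  have hρ : ∫ x, ∫ v, v ^ 2 * gain T₁ T₂ α f (x, v)
      = α * (∫ x, pressure f x) + (1 - α) * ((T₁ + T₂) / 2) := by
    rw [← integral_const_mul]
    have : (1 - α) * ((T₁ + T₂) / 2) = ∫ x, (1 - α) * ((T₁ + T₂) / 2) * density f x := by
      rw [integral_const_mul, hf.integral_density, mul_one]
    rw [this, ← integral_add (hf.integrable_pressure.const_mul _)
      (hf.integrable_density.const_mul _)]
    refine integral_congr_ae ?_
    filter_upwards [hf.ae_gain_section h₁ h₂] with x hx using hx.2.2.2
  have hP : ∫ x, ∫ v, v ^ 2 * f (x, v) = ∫ x, pressure f x := rfl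
  simp only [hρ, hP] at h
  have : (1 - α) * ((∫ x, pressure f x) - (T₁ + T₂) / 2) = 0 := by linarith
  rcases mul_eq_zero.1 this with h | h <;> linarith

/-- Mass conservation makes the momentum constant, momentum conservation makes the pressure
constant, and the energy balance with the reservoirs fixes its value. -/
lemma ae_pressure_eq (hf : IsSteadyState T₁ T₂ α f) (h₁ : 0 < T₁)
    (h₂ : 0 < T₂) (hα0 : 0 ≤ α) (hα1 : α < 1) :
    ∀ᵐ x, pressure f x = (T₁ + T₂) / 2 := by
  have hi : Integrable fun x => pressure f x - (T₁ + T₂) / 2 :=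
    hf.integrable_pressure.sub (integrable_const _)
  have h := ae_eq_zero_of_fourier hi fun k => by
    have e (x : UnitAddCircle) : ((pressure f x - (T₁ + T₂) / 2 : ℝ) : ℂ) * fourier k x
        = fourier k x * (pressure f x : ℂ) - ((T₁ + T₂) / 2 : ℝ) * fourier k x := by
      push_cast; ring
    by_cases hk : k = 0
    · subst hk
      simp only [fourier_zero, mul_one]
      rw [integral_complex_ofReal, integral_sub hf.integrable_pressure (integrable_const _),
        hf.integral_pressure h₁ h₂ hα0 hα1]
      simp
    · simp only [e]
      rw [integral_sub, integral_const_mul, integral_fourier_eq_zero hk,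
        hf.integral_fourier_mul_pressure h₁ h₂ hα0 hα1.le hk]
      · simp
      · exact hf.integrable_pressure.ofReal.bdd_mul (c := 1)
          (fourier k).continuous.aestronglyMeasurable
          (.of_forall fun z => by simp only [fourier_apply, Circle.norm_coe, le_refl])
      · exact ((fourier k).continuous.integrable_of_hasCompactSupport
          (HasCompactSupport.of_compactSpace _)).const_mul _
  filter_upwards [h] with x hx
  linarith

/-- The mild form of the steady equation, in duality with continuous functions of `x`. -/
lemma integral_mul_eq_integral_gain_mul_flightAverage (hf : IsSteadyState T₁ T₂ α f)
    (h₁ : 0 < T₁) (h₂ : 0 < T₂) (hα0 : 0 ≤ α) (hα1 : α ≤ 1) (ψ : C(UnitAddCircle, ℝ)) :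
    ∫ z, f z * ψ z.1 = ∫ z, gain T₁ T₂ α f z * flightAverage ψ z := by
  have hG := hf.integrable_gain h₁ h₂ hα0 hα1
  refine integral_mul_eq_flightAverage_of_fourier hf.integrable hG (fun k => ?_) ψ
  have hre (v : ℝ) : 1 ≤ ‖1 - 2 * Real.pi * Complex.I * k * v‖ := by
    refine le_trans (le_of_eq ?_) ((le_abs_self _).trans (Complex.abs_re_le_norm _))
    simp
  have hne (v : ℝ) : (1 - 2 * Real.pi * Complex.I * k * v : ℂ) ≠ 0 := fun h => by
    have := hre v
    rw [h, norm_zero] at this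
    linarith
  have hY (z : Phase) : (1 - 2 * Real.pi * Complex.I * k * z.2 : ℂ)⁻¹
      * modeDefect f (gain T₁ T₂ α f) k z
      = (gain T₁ T₂ α f z : ℂ) * flightAverage (fourier k : C(UnitAddCircle, ℂ)) z
        - (f z : ℂ) * fourier k z.1 := by
    rw [modeDefect, flightAverage_fourier]
    have := hne z.2
    field_simp
  have hi := (hf.integrable_modeDefect hG k).bdd_mul (c := 1)
    (f := fun z : Phase => (1 - 2 * Real.pi * Complex.I * k * z.2 : ℂ)⁻¹)
    (Measurable.aestronglyMeasurable (by fun_prop))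
    (.of_forall fun z => by rw [norm_inv]; exact inv_le_one_of_one_le₀ (hre _))
  have h := hf.integral_mul_modeDefect hG k
    (w := fun v => (1 - 2 * Real.pi * Complex.I * k * v : ℂ)⁻¹) hi
  simp only [hY] at h
  rw [integral_sub, sub_eq_zero] at h
  · exact h.symm
  · exact hG.ofReal.mul_bdd (c := ‖(fourier k : C(UnitAddCircle, ℂ))‖)
      (continuous_flightAverage _).aestronglyMeasurable
      (.of_forall fun z => norm_flightAverage_le _ z)
  · simpa only [mul_comm] using integrable_fourier_mul hf.integrable k

end IsSteadyState

/-! ### The uniform state is a steady state -/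

lemma integrable_uniformState (h₁ : 0 < T₁) (h₂ : 0 < T₂) :
    Integrable (uniformState T₁ T₂ α) :=
  ((integrable_maxwellian (by positivity)).const_mul α).add
    ((integrable_reservoir h₁ h₂).const_mul (1 - α))

lemma integral_uniformState (h₁ : 0 < T₁) (h₂ : 0 < T₂) : ∫ v, uniformState T₁ T₂ α v = 1 := by
  have hT : 0 < (T₁ + T₂) / 2 := by positivity
  unfold uniformState
  rw [integral_add ((integrable_maxwellian hT.le).const_mul α)
    ((integrable_reservoir h₁ h₂).const_mul _), integral_const_mul, integral_const_mul,
    integral_maxwellian hT, integral_reservoir h₁ h₂]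
  ring

lemma sq_mul_uniformState (v : ℝ) : v ^ 2 * uniformState T₁ T₂ α v
    = α * (v ^ 2 * maxwellian ((T₁ + T₂) / 2) v) + (1 - α) * (v ^ 2 * reservoir T₁ T₂ v) := by
  unfold uniformState; ring

lemma integrable_sq_mul_uniformState (h₁ : 0 < T₁) (h₂ : 0 < T₂) :
    Integrable fun v => v ^ 2 * uniformState T₁ T₂ α v := by
  simp only [sq_mul_uniformState]
  exact ((integrable_sq_mul_maxwellian (by positivity)).const_mul α).add
    ((integrable_sq_mul_reservoir h₁ h₂).const_mul (1 - α))

lemma integral_sq_mul_uniformState (h₁ : 0 < T₁) (h₂ : 0 < T₂) :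
    ∫ v, v ^ 2 * uniformState T₁ T₂ α v = (T₁ + T₂) / 2 := by
  have hT : 0 < (T₁ + T₂) / 2 := by positivity
  simp only [sq_mul_uniformState]
  rw [integral_add ((integrable_sq_mul_maxwellian hT.le).const_mul α)
    ((integrable_sq_mul_reservoir h₁ h₂).const_mul _), integral_const_mul, integral_const_mul,
    integral_sq_mul_maxwellian hT.le, integral_sq_mul_reservoir h₁ h₂]
  ring

lemma density_uniformState (h₁ : 0 < T₁) (h₂ : 0 < T₂) :
    density (fun z => uniformState T₁ T₂ α z.2) = fun _ => 1 :=
  funext fun _ => integral_uniformState h₁ h₂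

lemma gain_uniformState (h₁ : 0 < T₁) (h₂ : 0 < T₂) (z : Phase) :
    gain T₁ T₂ α (fun z => uniformState T₁ T₂ α z.2) z = uniformState T₁ T₂ α z.2 := by
  have hP : pressure (fun z => uniformState T₁ T₂ α z.2) z.1 = (T₁ + T₂) / 2 :=
    integral_sq_mul_uniformState h₁ h₂
  rw [gain, localMaxwellian, temperature, hP, density_uniformState h₁ h₂, div_one, one_mul,
    mul_one, uniformState]

lemma integral_dx_eq_zero {φ : Phase → ℝ} (hφ : IsTest φ) (v : ℝ) : ∫ x, dx φ (x, v) = 0 := by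
  set u : ℝ → ℝ := fun t => φ ((t : UnitAddCircle), v) with hu
  have hsmooth : ContDiff ℝ ∞ u := hφ.1.comp (contDiff_id.prodMk contDiff_const)
  have h (t : ℝ) : dx φ ((t : UnitAddCircle), v) = deriv u t := by
    have := deriv_comp_const_add (f := u) t 0
    rw [add_zero] at this
    rw [← this]
    simp only [dx, hu, AddCircle.coe_add]
  rw [← UnitAddCircle.intervalIntegral_preimage 0 fun x => dx φ (x, v)]
  simp only [h]
  rw [intervalIntegral.integral_deriv_eq_sub
    (fun t _ => (hsmooth.differentiable (by simp)).differentiableAt)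
    ((hsmooth.continuous_deriv (by simp)).intervalIntegrable _ _)]
  have h10 : ((1 : ℝ) : UnitAddCircle) = ((0 : ℝ) : UnitAddCircle) := AddCircle.coe_period 1
  simp only [hu, zero_add, h10, sub_self]

theorem isSteadyState_uniformState (h₁ : 0 < T₁) (h₂ : 0 < T₂) (hα0 : 0 ≤ α) (hα1 : α ≤ 1) :
    IsSteadyState T₁ T₂ α fun z => uniformState T₁ T₂ α z.2 where
  integrable := (integrable_uniformState h₁ h₂).comp_snd _
  nonneg := .of_forall fun z => by
    have := maxwellian_nonneg ((T₁ + T₂) / 2) z.2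
    have := reservoir_nonneg (T₁ := T₁) (T₂ := T₂) z.2
    have : 0 ≤ 1 - α := by linarith
    unfold uniformState; positivity
  mass_one := by
    rw [Measure.volume_eq_prod, integral_prod _ ((integrable_uniformState h₁ h₂).comp_snd _)]
    simp [integral_uniformState h₁ h₂]
  second_moment := (integrable_sq_mul_uniformState h₁ h₂).comp_snd _
  weak_eq := fun φ hφ => by
    simp only [gain_uniformState h₁ h₂, sub_self, zero_mul, integral_zero, neg_eq_zero]
    -- Fubini needs integrability; otherwise the integral is zero by convention
    by_cases hi : Integrable fun z : Phase => z.2 * uniformState T₁ T₂ α z.2 * dx φ z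
    · rw [Measure.volume_eq_prod, integral_prod_symm _ hi]
      simp only [integral_const_mul, integral_dx_eq_zero hφ, mul_zero, integral_zero]
    · exact integral_undef hi

/-! ### Contraction of the density and uniqueness -/

namespace IsSteadyState

/-- At constant pressure the temperature is a function of the density. -/
lemma ae_localMaxwellian_eq (hf : IsSteadyState T₁ T₂ α f) (h₁ : 0 < T₁)
    (h₂ : 0 < T₂) (hα0 : 0 ≤ α) (hα1 : α < 1) :
    ∀ᵐ x, 0 < density f x ∧ ∀ v, localMaxwellian f (x, v)
      = density f x * maxwellian ((T₁ + T₂) / 2 / density f x) v := by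
  filter_upwards [hf.ae_pressure_eq h₁ h₂ hα0 hα1, hf.ae_density_nonneg,
    hf.ae_density_eq_zero_iff] with x hP hρ hiff
  refine ⟨lt_of_le_of_ne hρ fun h => ?_, fun v => ?_⟩
  · have := hiff.1 h.symm
    linarith
  · simp only [localMaxwellian, temperature, hP]

lemma integrable_localMaxwellian (hf : IsSteadyState T₁ T₂ α f) (h₁ : 0 < T₁)
    (h₂ : 0 < T₂) (hα0 : 0 ≤ α) (hα1 : α < 1) : Integrable (localMaxwellian f) := by
  have h := hf.ae_localMaxwellian_eq h₁ h₂ hα0 hα1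
  refine (integrable_prod_iff hf.aestronglyMeasurable_localMaxwellian).2
    ⟨?_, hf.integrable_density.congr ?_⟩
  · filter_upwards [h] with x hx
    simp only [hx.2]
    have := hx.1
    exact (integrable_maxwellian (by positivity)).const_mul _
  · filter_upwards [h] with x hx
    have := hx.1
    have hn (v : ℝ) : ‖localMaxwellian f (x, v)‖
        = density f x * maxwellian ((T₁ + T₂) / 2 / density f x) v := by
      rw [hx.2, Real.norm_of_nonneg (mul_nonneg hx.1.le (maxwellian_nonneg _ _))]
    simp only [hn]
    rw [integral_const_mul, integral_maxwellian (by positivity), mul_one]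

/-- The nonlinear part of the gain term is Lipschitz in the density, in `L¹`. -/
lemma integral_abs_localMaxwellian_sub_le (hf : IsSteadyState T₁ T₂ α f) (h₁ : 0 < T₁)
    (h₂ : 0 < T₂) (hα0 : 0 ≤ α) (hα1 : α < 1) :
    ∫ z : Phase, |localMaxwellian f z - maxwellian ((T₁ + T₂) / 2) z.2|
      ≤ 3 * ∫ x, |density f x - 1| := by
  have hi : Integrable fun z : Phase =>
      localMaxwellian f z - maxwellian ((T₁ + T₂) / 2) z.2 :=
    (hf.integrable_localMaxwellian h₁ h₂ hα0 hα1).sub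
      ((integrable_maxwellian (by positivity)).comp_snd _)
  rw [Measure.volume_eq_prod, integral_prod _ hi.abs, ← integral_const_mul]
  refine integral_mono_ae hi.abs.integral_prod_left
    ((hf.integrable_density.sub (integrable_const 1)).abs.const_mul 3) ?_
  filter_upwards [hf.ae_localMaxwellian_eq h₁ h₂ hα0 hα1] with x hx
  simp only [hx.2]
  exact integral_abs_isobaric_sub_le (by positivity) hx.1

/-- Testing the mild form, the reservoirs contract `ρ - 1` by Doeblin's argument, because
`ρ - 1` has mean zero, and the nonlinear part costs at most `3 α ‖ρ - 1‖₁`. -/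
lemma integral_abs_density_sub_one_le (hf : IsSteadyState T₁ T₂ α f) (h₁ : 0 < T₁)
    (h₂ : 0 < T₂) (hα0 : 0 ≤ α) (hα1 : α < 1) {r : ℝ} (hr : 0 ≤ r)
    (hRr : ∀ v, 0 ≤ v → v ≤ 1 → r ≤ reservoir T₁ T₂ v) :
    ∫ x, |density f x - 1|
      ≤ ((1 - α) * (1 - r * (Real.exp (-2) / 2)) + 3 * α) * ∫ x, |density f x - 1| := by
  have hT : 0 < (T₁ + T₂) / 2 := by positivity
  have hh : Integrable fun x => density f x - 1 := hf.integrable_density.sub (integrable_const 1)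
  have hmean : ∫ x, (density f x - 1) = 0 := by
    rw [integral_sub hf.integrable_density (integrable_const 1), hf.integral_density]
    simp
  have hu := isSteadyState_uniformState h₁ h₂ hα0 hα1.le
  have hE : Integrable fun z : Phase =>
      localMaxwellian f z - maxwellian ((T₁ + T₂) / 2) z.2 :=
    (hf.integrable_localMaxwellian h₁ h₂ hα0 hα1).sub ((integrable_maxwellian hT.le).comp_snd _)
  have hhR : Integrable fun z : Phase => (density f z.1 - 1) * reservoir T₁ T₂ z.2 :=
    hh.mul_prod (integrable_reservoir h₁ h₂)
  refine integral_abs_le_of_forall_continuous hh fun ψ hψ => ?_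
  have hψn : ‖ψ‖ ≤ 1 := (ContinuousMap.norm_le _ zero_le_one).2 hψ
  have hψb (F : Phase → ℝ) (hF : Integrable F) : Integrable fun z => F z * ψ z.1 :=
    hF.mul_bdd (c := 1) (ψ.continuous.comp continuous_fst).aestronglyMeasurable
      (.of_forall fun z => hψ z.1)
  -- the mild form of `f` minus that of the uniform state
  have hmild : ∫ x, (density f x - 1) * ψ x
      = α * (∫ z, (localMaxwellian f z - maxwellian ((T₁ + T₂) / 2) z.2) * flightAverage ψ z)
        + (1 - α) * ∫ z : Phase, (density f z.1 - 1) * reservoir T₁ T₂ z.2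
          * flightAverage ψ z := by
    have e1 := hf.integral_mul_eq_integral_gain_mul_flightAverage h₁ h₂ hα0 hα1.le ψ
    have e2 := hu.integral_mul_eq_integral_gain_mul_flightAverage h₁ h₂ hα0 hα1.le ψ
    simp only [gain_uniformState h₁ h₂] at e2
    have iE := integrable_mul_flightAverage hE ψ
    have iR := integrable_mul_flightAverage hhR ψ
    have iG := integrable_mul_flightAverage (hf.integrable_gain h₁ h₂ hα0 hα1.le) ψ
    have iU := integrable_mul_flightAverage hu.integrable ψ
    rw [← integral_const_mul, ← integral_const_mul,
      ← integral_add (iE.const_mul _) (iR.const_mul _)]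
    have e3 (z : Phase) : α * ((localMaxwellian f z - maxwellian ((T₁ + T₂) / 2) z.2)
          * flightAverage ψ z) + (1 - α) * ((density f z.1 - 1) * reservoir T₁ T₂ z.2
          * flightAverage ψ z)
        = gain T₁ T₂ α f z * flightAverage ψ z
          - uniformState T₁ T₂ α z.2 * flightAverage ψ z := by
      simp only [gain, uniformState]; ring
    simp only [e3]
    rw [integral_sub iG iU, ← e1, ← e2, ← integral_sub (hψb _ hf.integrable)
      (hψb _ hu.integrable)]
    have iS := (hψb _ hf.integrable).sub (hψb _ hu.integrable)
    rw [Measure.volume_eq_prod]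
    refine Eq.trans ?_ (integral_prod _ iS).symm
    refine integral_congr_ae ?_
    filter_upwards [hf.integrable.prod_right_ae] with x hx
    simp only [Pi.sub_apply, ← sub_mul]
    rw [integral_mul_const, integral_sub hx (integrable_uniformState h₁ h₂),
      integral_uniformState h₁ h₂]
    rfl
  have hnonlin : ∫ z, (localMaxwellian f z - maxwellian ((T₁ + T₂) / 2) z.2) * flightAverage ψ z
      ≤ 3 * ∫ x, |density f x - 1| := by
    refine le_trans (integral_mono (integrable_mul_flightAverage hE ψ) hE.abs fun z => ?_)
      (hf.integral_abs_localMaxwellian_sub_le h₁ h₂ hα0 hα1)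
    refine (le_abs_self _).trans ?_
    rw [abs_mul]
    exact mul_le_of_le_one_right (abs_nonneg _) ((norm_flightAverage_le ψ z).trans hψn)
  have hlin : ∫ z : Phase, (density f z.1 - 1) * reservoir T₁ T₂ z.2 * flightAverage ψ z
      ≤ (1 - r * (Real.exp (-2) / 2)) * ∫ x, |density f x - 1| := by
    have iR := integrable_mul_flightAverage hhR ψ
    have iΦ := iR.integral_prod_left
    rw [Measure.volume_eq_prod, integral_prod _ iR]
    have hm : Integrable fun x => (density f x - 1) * (r * (Real.exp (-2) / 2) * ∫ y, ψ y) :=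
      hh.mul_const _
    -- subtracting the mean of `ψ` does not change the integral against `ρ - 1`
    have e : ∫ x, ∫ v, (density f x - 1) * reservoir T₁ T₂ v * flightAverage ψ (x, v)
        = ∫ x, ((∫ v, (density f x - 1) * reservoir T₁ T₂ v * flightAverage ψ (x, v))
          - (density f x - 1) * (r * (Real.exp (-2) / 2) * ∫ y, ψ y)) := by
      rw [integral_sub iΦ hm, integral_mul_const, hmean, zero_mul, sub_zero]
    rw [e, ← integral_const_mul (1 - r * (Real.exp (-2) / 2))]
    refine integral_mono (iΦ.sub hm) (hh.abs.const_mul _) fun x => ?_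
    have hD := abs_integral_mul_flightAverage_sub_le (integrable_reservoir h₁ h₂)
      reservoir_nonneg (integral_reservoir h₁ h₂) hr hRr ψ hψ x
    simp only [mul_assoc (density f x - 1), integral_const_mul]
    rw [← mul_sub]
    refine (le_abs_self _).trans ?_
    rw [abs_mul, mul_comm]
    gcongr
  rw [hmild]
  have h1 : 0 ≤ 1 - α := by linarith
  nlinarith [mul_le_mul_of_nonneg_left hnonlin hα0, mul_le_mul_of_nonneg_left hlin h1]

/-- Once the density is constant, the gain term is `uniformState`, and the transport operator
`v ∂ₓ + 1` is injective. -/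
lemma ae_eq_uniformState_of_density_eq_one (hf : IsSteadyState T₁ T₂ α f) (h₁ : 0 < T₁)
    (h₂ : 0 < T₂) (hα0 : 0 ≤ α) (hα1 : α < 1) (hρ : ∀ᵐ x, density f x = 1) :
    ∀ᵐ z : Phase, f z = uniformState T₁ T₂ α z.2 := by
  have hG := hf.integrable_gain h₁ h₂ hα0 hα1.le
  have hgain : ∀ᵐ x, ∀ v, gain T₁ T₂ α f (x, v) = uniformState T₁ T₂ α v := by
    filter_upwards [hρ, hf.ae_localMaxwellian_eq h₁ h₂ hα0 hα1] with x hx hM v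
    simp only [gain, hM.2, hx, uniformState]
    ring_nf
  have hi : Integrable fun z : Phase => f z - uniformState T₁ T₂ α z.2 :=
    hf.integrable.sub ((integrable_uniformState h₁ h₂).comp_snd _)
  have hv : ∀ᵐ v : ℝ, ∀ᵐ x : UnitAddCircle, f (x, v) - uniformState T₁ T₂ α v = 0 := by
    filter_upwards [ae_all_iff.2 fun k => hf.ae_integral_modeDefect hG k,
      hf.integrable.prod_left_ae] with v hmode hfi
    have hsec : Integrable fun x => f (x, v) - uniformState T₁ T₂ α v :=
      hfi.sub (integrable_const _)
    refine ae_eq_zero_of_fourier hsec fun k => ?_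
    have ie : Integrable fun x : UnitAddCircle => (fourier k x : ℂ) :=
      (fourier k).continuous.integrable_of_hasCompactSupport (HasCompactSupport.of_compactSpace _)
    have ief : Integrable fun x : UnitAddCircle => (fourier k x : ℂ) * f (x, v) :=
      hfi.ofReal.bdd_mul (c := 1) (fourier k).continuous.aestronglyMeasurable
        (.of_forall fun z => by simp only [fourier_apply, Circle.norm_coe, le_refl])
    have hk := hmode k
    have e : ∫ x, modeDefect f (gain T₁ T₂ α f) k (x, v)
        = ∫ x, ((uniformState T₁ T₂ α v : ℂ) * fourier k x
          - (1 - 2 * Real.pi * Complex.I * k * v) * (fourier k x * f (x, v))) := by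
      refine integral_congr_ae ?_
      filter_upwards [hgain] with x hx
      simp only [modeDefect, hx]; ring
    rw [e, integral_sub (ie.const_mul _) (ief.const_mul _), integral_const_mul,
      integral_const_mul] at hk
    have e2 (x : UnitAddCircle) : ((f (x, v) - uniformState T₁ T₂ α v : ℝ) : ℂ) * fourier k x
        = fourier k x * f (x, v) - uniformState T₁ T₂ α v * fourier k x := by
      push_cast; ring
    simp only [e2]
    rw [integral_sub ief (ie.const_mul _), integral_const_mul]
    by_cases h0 : k = 0
    · subst h0
      simp only [Int.cast_zero, mul_zero, zero_mul, sub_zero, one_mul] at hk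
      rw [← neg_eq_zero, neg_sub]
      exact hk
    · rw [integral_fourier_eq_zero h0, mul_zero, sub_zero]
      rw [integral_fourier_eq_zero h0, mul_zero, zero_sub, neg_eq_zero] at hk
      refine (mul_eq_zero.1 hk).resolve_left fun h => ?_
      simpa using congrArg Complex.re h
  have h0 : ∫ z : Phase, |f z - uniformState T₁ T₂ α z.2| = 0 := by
    rw [Measure.volume_eq_prod, integral_prod_symm _ hi.abs]
    refine integral_eq_zero_of_ae ?_
    filter_upwards [hv] with v hx
    refine integral_eq_zero_of_ae ?_
    filter_upwards [hx] with x hx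
    simp [hx]
  filter_upwards [(integral_eq_zero_iff_of_nonneg (fun z => abs_nonneg _) hi.abs).1 h0] with z hz
  exact sub_eq_zero.1 (abs_eq_zero.1 hz)

end IsSteadyState

/-! ### The explicit threshold -/

/-- The number `a N` for which `1 / (a N + 1)` is an admissible threshold `α₀` whenever
`1 / N ≤ T₁, T₂ ≤ N`. -/
def threshold (N : ℕ) : ℕ := 144 * N * 2 ^ N

lemma computable_threshold : Computable threshold := by
  have hpow : Primrec₂ fun m n : ℕ => m ^ n := Primrec₂.unpaired'.1 Nat.Primrec.pow
  exact (Primrec.nat_mul.comp (Primrec.nat_mul.comp (Primrec.const 144) Primrec.id)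
    (hpow.comp (Primrec.const 2) Primrec.id)).to_comp

/-- The lower bound `exp (-N / 2) / √(2πN)` of the reservoir profile on `[0, 1]` gives the Doeblin
constant `c`, and `3 / c ≤ threshold N + 1`. -/
lemma threshold_bound {N : ℕ} (hN : 1 ≤ N) :
    3 / ((threshold N : ℝ) + 1) ≤
      Real.exp (-N / 2) / Real.sqrt (2 * Real.pi * N) * (Real.exp (-2) / 2) := by
  have hN' : (1 : ℝ) ≤ N := by exact_mod_cast hN
  have he : Real.exp 1 < 2.7182818286 := Real.exp_one_lt_d9
  have hsqrt : Real.sqrt (2 * Real.pi * N) ≤ 3 * N := by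
    rw [Real.sqrt_le_left (by positivity)]
    nlinarith [Real.pi_lt_d2]
  have hexp : Real.exp (N / 2) ≤ 2 ^ N := by
    have h1 : Real.exp (1 / 2) ≤ 2 := by
      have h2 : Real.exp (1 / 2) ^ 2 = Real.exp 1 := by
        rw [← Real.exp_nat_mul]; norm_num
      nlinarith [Real.exp_pos (1 / 2)]
    calc Real.exp (N / 2) = Real.exp (1 / 2) ^ N := by
          rw [← Real.exp_nat_mul]; ring_nf
      _ ≤ 2 ^ N := by gcongr
  have he2 : Real.exp 2 ≤ 8 := by
    have : Real.exp 2 = Real.exp 1 ^ 2 := by rw [← Real.exp_nat_mul]; norm_num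
    rw [this]
    nlinarith [Real.exp_pos 1]
  have hs0 : 0 < Real.sqrt (2 * Real.pi * N) := Real.sqrt_pos.2 (by positivity)
  rw [neg_div, Real.exp_neg, Real.exp_neg]
  have e : (Real.exp (N / 2))⁻¹ / Real.sqrt (2 * Real.pi * N) * ((Real.exp 2)⁻¹ / 2)
      = 3 / (6 * (Real.exp (N / 2) * Real.sqrt (2 * Real.pi * N) * Real.exp 2)) := by
    field_simp; norm_num
  rw [e]
  gcongr
  calc 6 * (Real.exp (N / 2) * Real.sqrt (2 * Real.pi * N) * Real.exp 2)
      ≤ 6 * (2 ^ N * (3 * N) * 8) := by gcongr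
    _ ≤ (threshold N : ℝ) + 1 := by
        simp only [threshold]; push_cast; linarith

end BGK

/-- The threshold is `α₀ = 1 / (a N + 1)`, where `a : ℕ → ℕ` is a computable function and `N` is
any natural number with `1 / N ≤ T₁, T₂ ≤ N`. -/
theorem theorem1p1 :
    ∃ a : ℕ → ℕ, Computable a ∧
      ∀ T₁ T₂ : ℝ, 0 < T₁ → 0 < T₂ →
      ∀ N : ℕ, T₁ ≤ N → T₂ ≤ N → 1 / T₁ ≤ N → 1 / T₂ ≤ N →
      ∀ α : ℝ, 0 ≤ α → α < 1 / ((a N : ℝ) + 1) →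
        (BGK.IsSteadyState T₁ T₂ α (fun z => BGK.uniformState T₁ T₂ α z.2) ∧
          ∀ p : ENNReal, MeasureTheory.MemLp
            (BGK.density (fun z => BGK.uniformState T₁ T₂ α z.2)) p MeasureTheory.volume) ∧
        ∀ (f : BGK.Phase → ℝ) (p : ENNReal), 1 < p →
          BGK.IsSteadyState T₁ T₂ α f →
          MeasureTheory.MemLp (BGK.density f) p MeasureTheory.volume →
            (∃ g : ℝ → ℝ, ∀ᵐ z : BGK.Phase, f z = g z.2) ∧
            ∀ᵐ z : BGK.Phase, f z = BGK.uniformState T₁ T₂ α z.2 := by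
  refine ⟨BGK.threshold, BGK.computable_threshold, fun T₁ T₂ h₁ h₂ N hN₁ hN₂ hN₁' hN₂' α hα0 hα =>
    ?_⟩
  have hN : 1 ≤ N := Nat.one_le_iff_ne_zero.2 fun h => by
    subst h; simp at hN₁; linarith
  have hα1 : α < 1 := by
    refine hα.trans_le ((div_le_one (by positivity)).2 ?_)
    have : (0 : ℝ) ≤ BGK.threshold N := Nat.cast_nonneg _
    linarith
  refine ⟨⟨BGK.isSteadyState_uniformState h₁ h₂ hα0 hα1.le, fun p => ?_⟩, fun f p _ hf _ => ?_⟩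
  · rw [BGK.density_uniformState h₁ h₂]
    exact memLp_const 1
  · suffices h : ∀ᵐ z : BGK.Phase, f z = BGK.uniformState T₁ T₂ α z.2 from ⟨⟨_, h⟩, h⟩
    refine hf.ae_eq_uniformState_of_density_eq_one h₁ h₂ hα0 hα1 ?_
    set r := Real.exp (-N / 2) / Real.sqrt (2 * Real.pi * N) with hr
    have hRr (v : ℝ) (hv0 : 0 ≤ v) (hv1 : v ≤ 1) : r ≤ BGK.reservoir T₁ T₂ v := by
      have := BGK.maxwellian_lower_bound h₁ hN₁ hN₁' hv0 hv1
      have := BGK.maxwellian_lower_bound h₂ hN₂ hN₂' hv0 hv1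
      unfold BGK.reservoir
      linarith
    have hle := hf.integral_abs_density_sub_one_le h₁ h₂ hα0 hα1 (by positivity : 0 ≤ r) hRr
    have hc := BGK.threshold_bound hN
    rw [← hr] at hc
    set c := r * (Real.exp (-2) / 2)
    have hc3 : 3 * α < c := by
      have : 3 / ((BGK.threshold N : ℝ) + 1) = 3 * (1 / ((BGK.threshold N : ℝ) + 1)) := by ring
      linarith
    have hc1 : c ≤ 1 := by
      have := (abs_nonneg _).trans (BGK.abs_integral_mul_flightAverage_sub_le
        (BGK.integrable_reservoir h₁ h₂) BGK.reservoir_nonneg (BGK.integral_reservoir h₁ h₂)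
        (by positivity : 0 ≤ r) hRr 0 (by simp) 0)
      exact sub_nonneg.1 this
    have hh : Integrable fun x => BGK.density f x - 1 :=
      hf.integrable_density.sub (integrable_const 1)
    have hnn : 0 ≤ ∫ x, |BGK.density f x - 1| := integral_nonneg fun x => abs_nonneg _
    have h0 : ∫ x, |BGK.density f x - 1| = 0 := by
      have : (1 - α) * (1 - c) + 3 * α < 1 := by nlinarith
      nlinarith
    filter_upwards [(integral_eq_zero_iff_of_nonneg (fun x => abs_nonneg _) hh.abs).1 h0]
      with x hx
    exact sub_eq_zero.1 (abs_eq_zero.1 hx)
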